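/- All triplets below are real: a triplet of size $p\ge 1$ consists of $A\in\mathbb R^{p\times p}$, a column $B\in\mathbb R^{p\times 1}$ and a row $C\in\mathbb R^{1\times p}$; $\dagger$ denotes the transpose. A triplet is *admissible* if it is minimal, i.e. $\bigcap_{r\ge 1}\ker CA^{r-1}=\bigcap_{r\ge 1}\ker B^\dagger(A^\dagger)^{r-1}=\{0\}$, if no eigenvalue of $A$ lies on the imaginary axis, and if no two eigenvalues of $A$ are symmetric to each other with respect to the imaginary axis. A triplet *leads to the potential* $u:\mathbb R^2\to\mathbb R$ if the Lyapunov equations $$A^\dagger Q+QA=C^\dagger C,\qquad AN+NA^\dagger=BB^\dagger$$ have unique solutions $Q$, $N$, the matrix $$F(x,t)=e^{2A^\dagger x-8(A^\dagger)^3t}+Q\,e^{-2Ax+8A^3t}N$$ is invertible for all $(x,t)\in\mathbb R^2$, and $u(x,t)=-2B^\dagger F(x,t)^{-1}C^\dagger$. Two triplets, possibly of different sizes, are *equivalent* if they lead to the same potential. **Theorem 4.3.** Every admissible triplet $(\tilde A,\tilde B,\tilde C)$ is equivalent to an admissible triplet $(A,B,C)$ of the following form: for some integer $m\ge 1$, $$A=\begin{pmatrix}A_1&&0\\&\ddots&\\0&&A_m\end{pmatrix},\qquad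 B=\begin{pmatrix}B_1\\\vdots\\B_m\end{pmatrix},\qquad C=\begin{pmatrix}C_1&\cdots&C_m\end{pmatrix},$$ where different blocks $A_j$ have no eigenvalue in common and where, for each $j$ and some $n_j\ge 1$, one of the following holds. (a) (real eigenvalue $\omega_j>0$) $A_j$ is the $n_j\times n_j$ matrix with $\omega_j$ on the diagonal, $-1$ on the first superdiagonal and $0$ elsewhere; $B_j=(0,\dots,0,1)^\dagger\in\mathbb R^{n_j}$; and $C_j=(c_{jn_j},\dots,c_{j2},c_{j1})$ with real entries and $c_{jn_j}\neq 0$. (b) (pair of eigenvalues $\alpha_j\pm i\beta_j$ with $\alpha_j>0$, $\beta_j>0$) $A_j$ is the $2n_j\times 2n_j$ matrix consisting of $2\times2$ blocks, with $\Lambda_j=\begin{pmatrix}\alpha_j&\beta_j\\-\beta_j&\alpha_j\end{pmatrix}$ on the block diagonal, $-I_2$ on the first block superdiagonal and $0$ elsewhere; $B_j=(0,\dots,0,1)^\dagger\in\mathbb R^{2n_j}$; and $C_j=(\gamma_{jn_j},\epsilon_{jn_j},\dots,\gamma_{j1},\epsilon_{j1})$ with real entries and $\gamma_{jn_j}^2+\epsilon_{jn_j}^2>0$.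 -/

import Mathlib

open scoped Matrix

/-- A real triplet `(A, B, C)` with a square matrix `A` indexed by `ι`, a column `B` and a row `C`.
-/
structure RealTriplet (ι : Type) where
  A : Matrix ι ι ℝ
  B : ι → ℝ
  C : ι → ℝ

namespace RealTriplet

variable {ι : Type} [Fintype ι] [DecidableEq ι]

/-- `z` is a (complex) eigenvalue of the real matrix `A`. -/
def IsEigenvalue (T : RealTriplet ι) (z : ℂ) : Prop :=
  Module.End.HasEigenvalue (Matrix.toLin' (T.A.map Complex.ofReal)) z

/-- Minimality of the realization `y ↦ C e^{-Ay} B`: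
`⋂ₖ ker (C Aᵏ) = {0}` and `⋂ₖ ker (Bᵀ (Aᵀ)ᵏ) = {0}`. -/
def IsMinimal (T : RealTriplet ι) : Prop :=
  (∀ v : ι → ℝ, (∀ k : ℕ, T.C ⬝ᵥ ((T.A ^ k) *ᵥ v) = 0) → v = 0) ∧
  (∀ v : ι → ℝ, (∀ k : ℕ, T.B ⬝ᵥ ((T.Aᵀ ^ k) *ᵥ v) = 0) → v = 0)

/-- The admissible class: real minimal triplets such that no eigenvalue of `A` lies on the
imaginary axis and no two eigenvalues are symmetric with respect to the imaginary axis
(the reflection of `z` in that axis is `-conj z`). -/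
structure IsAdmissible (T : RealTriplet ι) : Prop where
  minimal : T.IsMinimal
  re_ne_zero : ∀ z : ℂ, T.IsEigenvalue z → z.re ≠ 0
  not_symm : ∀ z w : ℂ, T.IsEigenvalue z → T.IsEigenvalue w → w ≠ -(starRingEnd ℂ) z

/-- The Lyapunov equation `Aᵀ Q + Q A = Cᵀ C`. -/
def SolvesQ (T : RealTriplet ι) (Q : Matrix ι ι ℝ) : Prop :=
  T.Aᵀ * Q + Q * T.A = Matrix.vecMulVec T.C T.C

/-- The Lyapunov equation `A N + N Aᵀ = B Bᵀ`. -/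
def SolvesN (T : RealTriplet ι) (N : Matrix ι ι ℝ) : Prop :=
  T.A * N + N * T.Aᵀ = Matrix.vecMulVec T.B T.B

/-- `F(x,t) = e^{2Aᵀx - 8(Aᵀ)³t} + Q e^{-2Ax + 8A³t} N`. -/
noncomputable def F (T : RealTriplet ι) (Q N : Matrix ι ι ℝ) (x t : ℝ) : Matrix ι ι ℝ :=
  NormedSpace.exp ((2 * x) • T.Aᵀ - (8 * t) • T.Aᵀ ^ 3) +
    Q * NormedSpace.exp (-((2 * x) • T.A) + (8 * t) • T.A ^ 3) * N

/-- The triplet leads to the potential `u`: both Lyapunov equations are uniquely solvable, and with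
their solutions `Q`, `N` the matrix `F(x,t)` is invertible on the whole `xt`-plane and
`u(x,t) = -2 Bᵀ F(x,t)⁻¹ Cᵀ`. -/
def LeadsTo (T : RealTriplet ι) (u : ℝ → ℝ → ℝ) : Prop :=
  ∃ Q N : Matrix ι ι ℝ,
    (T.SolvesQ Q ∧ ∀ Q', T.SolvesQ Q' → Q' = Q) ∧
    (T.SolvesN N ∧ ∀ N', T.SolvesN N' → N' = N) ∧
    ∀ x t : ℝ, IsUnit (T.F Q N x t) ∧
      u x t = -2 * (T.B ⬝ᵥ ((T.F Q N x t)⁻¹ *ᵥ T.C))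

/-- Two triplets (possibly of different sizes) are equivalent if they lead to the same
potential. -/
def Equivalent {κ : Type} [Fintype κ] [DecidableEq κ]
    (T : RealTriplet ι) (S : RealTriplet κ) : Prop :=
  ∃ u : ℝ → ℝ → ℝ, T.LeadsTo u ∧ S.LeadsTo u

end RealTriplet

/-- The data of one canonical block; the order of the Jordan block is `n + 1`.
`real ω n c` belongs to the real eigenvalue `ω`, and `pair α β n γ ε` to the pair `α ± iβ`.
The constants `c₁, …, c_{n+1}` are stored as `c 0, …, c n`, and likewise for `γ`, `ε`. -/
inductive CanonicalBlock where
  | real (ω : ℝ) (n : ℕ) (c : Fin (n + 1) → ℝ)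
  | pair (α β : ℝ) (n : ℕ) (γ ε : Fin (n + 1) → ℝ)

namespace CanonicalBlock

/-- Index set of the block: `n + 1` indices for a real eigenvalue, `2 (n + 1)` for a pair, where
`(k, a)` is the `a`-th position inside the `k`-th group of two. -/
def Idx : CanonicalBlock → Type
  | real _ n _ => Fin (n + 1)
  | pair _ _ n _ _ => Fin (n + 1) × Fin 2

instance instFintypeIdx : (b : CanonicalBlock) → Fintype b.Idx
  | real _ n _ => inferInstanceAs (Fintype (Fin (n + 1)))
  | pair _ _ n _ _ => inferInstanceAs (Fintype (Fin (n + 1) × Fin 2))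

instance instDecidableEqIdx : (b : CanonicalBlock) → DecidableEq b.Idx
  | real _ n _ => inferInstanceAs (DecidableEq (Fin (n + 1)))
  | pair _ _ n _ _ => inferInstanceAs (DecidableEq (Fin (n + 1) × Fin 2))

/-- The `2 × 2` matrix with rows `(α, β)` and `(-β, α)`. -/
def rotBlock (α β : ℝ) : Matrix (Fin 2) (Fin 2) ℝ :=
  !![α, β; -β, α]

/-- The matrix `A_j`: `ω` (resp. the `2 × 2` matrix `rotBlock α β`) on the diagonal and `-1`
(resp. minus the `2 × 2` unit matrix) on the first superdiagonal. -/
def matA : (b : CanonicalBlock) → Matrix b.Idx b.Idx ℝ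
  | real ω n _ => fun (i k : Fin (n + 1)) =>
      if k = i then ω else if (k : ℕ) = (i : ℕ) + 1 then -1 else 0
  | pair α β n _ _ => fun (i k : Fin (n + 1) × Fin 2) =>
      if k.1 = i.1 then rotBlock α β i.2 k.2
      else if (k.1 : ℕ) = (i.1 : ℕ) + 1 then -(1 : Matrix (Fin 2) (Fin 2) ℝ) i.2 k.2 else 0

/-- The column `B_j = (0, …, 0, 1)ᵀ`. -/
def colB : (b : CanonicalBlock) → b.Idx → ℝ
  | real _ n _ => fun (i : Fin (n + 1)) => if i = Fin.last n then 1 else 0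
  | pair _ _ n _ _ => fun (i : Fin (n + 1) × Fin 2) => if i = (Fin.last n, 1) then 1 else 0

/-- The row `C_j`, equal to `(c_{n+1}, …, c₁)` (resp. `(γ_{n+1}, ε_{n+1}, …, γ₁, ε₁)`). -/
def rowC : (b : CanonicalBlock) → b.Idx → ℝ
  | real _ n c => fun (i : Fin (n + 1)) => c i.rev
  | pair _ _ n γ ε => fun (i : Fin (n + 1) × Fin 2) =>
      if i.2 = 0 then γ i.1.rev else ε i.1.rev

/-- The eigenvalue of the block; for a pair, the one with imaginary part `β`. -/
def eigenvalue : CanonicalBlock → ℂ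
  | real ω _ _ => ⟨ω, 0⟩
  | pair α β _ _ _ => ⟨α, β⟩

/-- The constraints on the data: the eigenvalues have positive real part, those of a pair are
nonreal (with `β > 0`), and the leading coefficient(s) do not vanish. -/
def IsProper : CanonicalBlock → Prop
  | real ω n c => 0 < ω ∧ c (Fin.last n) ≠ 0
  | pair α β n γ ε => 0 < α ∧ 0 < β ∧ 0 < γ (Fin.last n) ^ 2 + ε (Fin.last n) ^ 2

/-- The triplet assembled from the blocks: `A` is block diagonal, `B` and `C` are concatenated. -/
def triplet {m : ℕ} (b : Fin m → CanonicalBlock) : RealTriplet (Σ j, (b j).Idx) where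
  A := Matrix.blockDiagonal' fun j => (b j).matA
  B := fun i => (b i.1).colB i.2
  C := fun i => (b i.1).rowC i.2

end CanonicalBlock

set_option linter.unusedSectionVars false

open Polynomial

/-! ### The Sylvester equation and coprime annihilating polynomials. -/

section Sylvester

variable {ι κ : Type} [Fintype ι] [DecidableEq ι] [Fintype κ] [DecidableEq κ]

/-! The potential is invariant under similarity, because `F` is only conjugated
(`IsSimilar.leadsTo`). Minimality makes the pair (A, B) cyclic: f ↦ f(A)B identifies the state space
with ℝ[X]/(χ), where χ is the characteristic polynomial (`krylov_eq_zero_iff`). Hence χ determines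
(A, B) up to similarity, and any controllable model with the same χ may be substituted, the row C
being carried along (`exists_isSimilar`).

Splitting χ by the sign of the real part of its roots turns the triplet into a direct sum T ⊕ S with
spectra in the right and left half-planes. The summand S is then reflected: its matrix A becomes
-Aᵀ, and the Lyapunov solutions undergo a partial inversion in the S-block (`flip`, `flipGram`). A
linear substitution carries F v = s C into the same system for the reflected triplet without
changing B · v (`F_mulVec_flip`), so the potential survives.

The T-blocks of the Lyapunov solutions are positive definite and the S-blocks negative definite, so
the reflected solutions are positive definite (`flipGram_pos`). This yields the invertibility of the
reflected `F` on the whole plane (`isUnit_F_of_pos`), hence that of the original one, and also the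
minimality of the reflected triplet (`SpectrumSplit.isObservable`).

With the spectrum now in the right half-plane, cyclicity is used again: one canonical block per real
eigenvalue or conjugate pair, of order its multiplicity, gives a controllable pair with the right χ
(`exists_isSimilar_triplet`). Observability of each block forces its leading coefficients not to
vanish. Unique solvability of the Lyapunov equations rests throughout on the coprimality of χ(X) and
χ(-X). -/

lemma Matrix.aeval_mul_eq_mul_aeval {A : Matrix κ κ ℝ} {A' : Matrix ι ι ℝ} {X : Matrix κ ι ℝ}
    (h : A * X = X * A') (f : ℝ[X]) : aeval A f * X = X * aeval A' f := by
  induction f using Polynomial.induction_on' with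
  | add p q hp hq => simp [Matrix.add_mul, Matrix.mul_add, hp, hq]
  | monomial n a =>
    have hn : A ^ n * X = X * A' ^ n := by
      induction n with
      | zero => simp
      | succ n ih => rw [pow_succ, Matrix.mul_assoc, h, ← Matrix.mul_assoc, ih, Matrix.mul_assoc,
          ← pow_succ]
    simp [aeval_monomial, Algebra.algebraMap_eq_smul_one, hn]

/-- Uniqueness for the homogeneous Sylvester equation `A X = X A'`. -/
lemma Matrix.eq_zero_of_mul_eq_mul_of_isCoprime {A : Matrix κ κ ℝ} {A' : Matrix ι ι ℝ}
    {X : Matrix κ ι ℝ} (h : A * X = X * A') {f g : ℝ[X]} (hf : aeval A f = 0)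
    (hg : aeval A' g = 0) (hfg : IsCoprime f g) : X = 0 := by
  obtain ⟨u, v, huv⟩ := hfg
  have h1 : aeval A' (u * f) = 1 := by
    have := congrArg (aeval A') huv
    simpa [hg] using this
  have h2 := Matrix.aeval_mul_eq_mul_aeval h (u * f)
  simpa [h1, hf] using h2.symm

lemma Matrix.aeval_neg_comp_neg_X (A : Matrix ι ι ℝ) (f : ℝ[X]) :
    aeval (-A) (f.comp (-X)) = aeval A f := by
  simp [aeval_comp]

lemma Matrix.aeval_transpose (A : Matrix ι ι ℝ) (f : ℝ[X]) :
    aeval Aᵀ f = (aeval A f)ᵀ := by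
  induction f using Polynomial.induction_on' with
  | add p q hp hq => simp [hp, hq]
  | monomial n a => simp [aeval_monomial, Algebra.algebraMap_eq_smul_one]

end Sylvester

/-! ### Spectra, Lyapunov equations and observability. -/

namespace RealTriplet

variable {ι : Type} [Fintype ι] [DecidableEq ι]

lemma isEigenvalue_iff_aeval_charpoly (T : RealTriplet ι) (z : ℂ) :
    T.IsEigenvalue z ↔ aeval z T.A.charpoly = 0 := by
  rw [IsEigenvalue, Module.End.hasEigenvalue_iff_isRoot_charpoly, Matrix.charpoly_toLin']
  have : (T.A.map Complex.ofReal) = T.A.map (algebraMap ℝ ℂ) := rfl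
  rw [this, Matrix.charpoly_map, IsRoot, eval_map, aeval_def]

/-- An eigenvalue is a root of the complex minimal polynomial, which divides every annihilating
polynomial. This locates spectra without computing characteristic polynomials. -/
lemma IsEigenvalue.aeval_eq_zero {T : RealTriplet ι} {z : ℂ} (hz : T.IsEigenvalue z) {f : ℝ[X]}
    (hf : aeval T.A f = 0) : aeval z f = 0 := by
  rw [IsEigenvalue, Module.End.hasEigenvalue_iff_isRoot] at hz
  have h : aeval (Matrix.toLin' (T.A.map Complex.ofReal)) (f.map (algebraMap ℝ ℂ)) = 0 := by
    have h1 : aeval (T.A.map Complex.ofReal) (f.map (algebraMap ℝ ℂ)) = 0 := by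
      rw [aeval_map_algebraMap]
      have := Polynomial.aeval_algHom_apply (Algebra.ofId ℝ ℂ).mapMatrix T.A f
      rw [hf, map_zero] at this
      exact this
    have := Polynomial.aeval_algHom_apply (Matrix.toLinAlgEquiv' (R := ℂ) (n := ι)).toAlgHom
      (T.A.map Complex.ofReal) (f.map (algebraMap ℝ ℂ))
    rw [h1, map_zero] at this
    exact this
  have h2 := hz.dvd (minpoly.dvd ℂ _ h)
  rwa [IsRoot, eval_map, ← aeval_def] at h2

/-- The spectra of `A` and `-A` are disjoint, in terms of characteristic polynomials. -/
def SpectrumSplit (T : RealTriplet ι) : Prop :=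
  IsCoprime T.A.charpoly (T.A.charpoly.comp (-X))

lemma spectrumSplit_of_forall {T : RealTriplet ι}
    (h : ∀ z, T.IsEigenvalue z → ¬ T.IsEigenvalue (-z)) : T.SpectrumSplit := by
  rw [SpectrumSplit, Polynomial.isCoprime_iff_aeval_ne_zero_of_isAlgClosed ℝ ℂ]
  intro z
  by_contra! hz
  refine h z ((isEigenvalue_iff_aeval_charpoly _ _).2 hz.1)
    ((isEigenvalue_iff_aeval_charpoly _ _).2 ?_)
  simpa [aeval_comp] using hz.2

lemma IsEigenvalue.conj {T : RealTriplet ι} {z : ℂ} (hz : T.IsEigenvalue z) :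
    T.IsEigenvalue ((starRingEnd ℂ) z) := by
  rw [isEigenvalue_iff_aeval_charpoly] at *
  rw [Polynomial.aeval_conj, hz, map_zero]

/-- The spectrum of a real matrix is closed under conjugation, so excluding pairs z, -conj z also
excludes pairs z, -z. -/
lemma IsAdmissible.spectrumSplit {T : RealTriplet ι} (hT : T.IsAdmissible) : T.SpectrumSplit :=
  spectrumSplit_of_forall fun z hz hz' => hT.not_symm _ _ hz.conj hz' (by simp)

lemma spectrumSplit_of_pos {T : RealTriplet ι} (h : ∀ z, T.IsEigenvalue z → 0 < z.re) :
    T.SpectrumSplit :=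
  spectrumSplit_of_forall fun z hz hz' => by
    have h1 := h _ hz
    have h2 := h _ hz'
    simp only [Complex.neg_re] at h2
    linarith

lemma IsMinimal.isAdmissible_of_pos {T : RealTriplet ι} (hT : T.IsMinimal)
    (h : ∀ z, T.IsEigenvalue z → 0 < z.re) : T.IsAdmissible where
  minimal := hT
  re_ne_zero z hz := (h z hz).ne'
  not_symm z w hz hw hzw := by
    have h1 := h _ hz
    have h2 := h _ hw
    simp only [hzw, Complex.neg_re, Complex.conj_re] at h2
    linarith

/-- The triplet with the transposed matrix and `B`, `C` interchanged. -/
def dual (T : RealTriplet ι) : RealTriplet ι := ⟨T.Aᵀ, T.C, T.B⟩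

lemma solvesN_iff_dual (T : RealTriplet ι) (N : Matrix ι ι ℝ) :
    T.SolvesN N ↔ T.dual.SolvesQ N := by
  simp [SolvesN, SolvesQ, dual]

lemma SpectrumSplit.dual {T : RealTriplet ι} (h : T.SpectrumSplit) : T.dual.SpectrumSplit := by
  simpa [SpectrumSplit, RealTriplet.dual, Matrix.charpoly_transpose] using h

lemma isEigenvalue_dual (T : RealTriplet ι) (z : ℂ) : T.dual.IsEigenvalue z ↔ T.IsEigenvalue z := by
  simp [isEigenvalue_iff_aeval_charpoly, dual, Matrix.charpoly_transpose]

/-- Observability of `(A, C)`. -/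
def IsObservable (T : RealTriplet ι) : Prop :=
  ∀ v : ι → ℝ, (∀ k : ℕ, T.C ⬝ᵥ ((T.A ^ k) *ᵥ v) = 0) → v = 0

lemma SpectrumSplit.eq_zero {T : RealTriplet ι} (h : T.SpectrumSplit) {Q : Matrix ι ι ℝ}
    (hQ : T.Aᵀ * Q + Q * T.A = 0) : Q = 0 := by
  refine Matrix.eq_zero_of_mul_eq_mul_of_isCoprime (A := T.Aᵀ) (A' := -T.A) (X := Q)
    (by rw [Matrix.mul_neg]; exact eq_neg_of_add_eq_zero_left hQ) (f := T.A.charpoly)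
    (g := T.A.charpoly.comp (-X)) ?_ ?_ h
  · rw [Matrix.aeval_transpose, Matrix.aeval_self_charpoly, Matrix.transpose_zero]
  · rw [Matrix.aeval_neg_comp_neg_X, Matrix.aeval_self_charpoly]

lemma SpectrumSplit.solvesQ_unique {T : RealTriplet ι} (h : T.SpectrumSplit) {Q Q' : Matrix ι ι ℝ}
    (hQ : T.SolvesQ Q) (hQ' : T.SolvesQ Q') : Q' = Q := by
  rw [← sub_eq_zero]
  apply h.eq_zero
  rw [Matrix.mul_sub, Matrix.sub_mul, sub_add_sub_comm, hQ, hQ', sub_self]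

/-- The Lyapunov operator is an injective endomorphism of a finite-dimensional space, hence
surjective. -/
lemma SpectrumSplit.exists_solvesQ {T : RealTriplet ι} (h : T.SpectrumSplit) :
    ∃ Q, T.SolvesQ Q := by
  let Φ : Matrix ι ι ℝ →ₗ[ℝ] Matrix ι ι ℝ :=
    LinearMap.mulLeft ℝ T.Aᵀ + LinearMap.mulRight ℝ T.A
  have hinj : Function.Injective Φ := by
    rw [injective_iff_map_eq_zero]
    exact fun Q hQ => h.eq_zero hQ
  exact (LinearMap.injective_iff_surjective.1 hinj) (Matrix.vecMulVec T.C T.C)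

lemma SpectrumSplit.solvesQ_transpose {T : RealTriplet ι} (h : T.SpectrumSplit) {Q : Matrix ι ι ℝ}
    (hQ : T.SolvesQ Q) : Qᵀ = Q := by
  refine h.solvesQ_unique hQ ?_
  have := congrArg Matrix.transpose hQ
  rw [SolvesQ]
  simpa [Matrix.transpose_vecMulVec, add_comm] using this

/-- If the Lyapunov solution `Q` is injective, then `(A, C)` is observable. -/
lemma SpectrumSplit.isObservable {T : RealTriplet ι} (h : T.SpectrumSplit) {Q : Matrix ι ι ℝ}
    (hQ : T.SolvesQ Q) (hinj : ∀ v, Q *ᵥ v = 0 → v = 0) : T.IsObservable := by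
  intro v hv
  have hC : ∀ f : ℝ[X], T.C ⬝ᵥ (aeval T.A f *ᵥ v) = 0 := by
    intro f
    rw [aeval_eq_sum_range, Matrix.sum_mulVec, dotProduct_sum]
    exact Finset.sum_eq_zero fun k _ => by simp [Matrix.smul_mulVec, hv k]
  -- On the cyclic space generated by an unobservable v the right-hand side of the Lyapunov equation
  -- vanishes, so Q intertwines -A with Aᵀ there.
  have hcomm : ∀ f : ℝ[X], T.Aᵀ *ᵥ (Q *ᵥ (aeval T.A f *ᵥ v)) = Q *ᵥ (aeval T.A (-X * f) *ᵥ v) := by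
    intro f
    have := congrArg (· *ᵥ (aeval T.A f *ᵥ v)) hQ
    simp only [Matrix.add_mulVec, Matrix.vecMulVec_mulVec, hC, MulOpposite.op_zero, zero_smul,
      ← Matrix.mulVec_mulVec] at this
    rw [eq_neg_of_add_eq_zero_left this, map_mul, map_neg, aeval_X, Matrix.neg_mul,
      Matrix.neg_mulVec, Matrix.mulVec_neg, Matrix.mulVec_mulVec _ T.A]
  have hpow : ∀ (k : ℕ) (f : ℝ[X]), (T.Aᵀ ^ k) *ᵥ (Q *ᵥ (aeval T.A f *ᵥ v)) =
      Q *ᵥ (aeval T.A ((-X) ^ k * f) *ᵥ v) := by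
    intro k
    induction k with
    | zero => simp
    | succ k ih =>
      intro f
      rw [pow_succ, ← Matrix.mulVec_mulVec, hcomm, ih, pow_succ, mul_assoc]
  have hpoly : ∀ g f : ℝ[X], aeval T.Aᵀ g *ᵥ (Q *ᵥ (aeval T.A f *ᵥ v)) =
      Q *ᵥ (aeval T.A (g.comp (-X) * f) *ᵥ v) := by
    intro g f
    induction g using Polynomial.induction_on' with
    | add p q hp hq =>
      rw [map_add, Matrix.add_mulVec, hp, hq, add_comp, add_mul, map_add, Matrix.add_mulVec,
        Matrix.mulVec_add]
    | monomial n a =>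
      have := congrArg (a • ·) (hpow n f)
      simp only [map_mul, map_pow, map_neg, aeval_X] at this
      simp only [aeval_monomial, monomial_comp, Algebra.algebraMap_eq_smul_one, map_mul, map_pow,
        map_neg, aeval_X, aeval_C, smul_mul_assoc, one_mul, Matrix.smul_mulVec, Matrix.mulVec_smul]
      exact this
  -- Bézout: r χ(X) + s χ(-X) = 1. Applying χ(Aᵀ) = 0 to Q s(A) v gives 0 = Q χ(-A) s(A) v = Q v.
  obtain ⟨r, s, hrs⟩ := h
  have h1 := hpoly T.A.charpoly s
  rw [Matrix.aeval_transpose, Matrix.aeval_self_charpoly, Matrix.transpose_zero,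
    Matrix.zero_mulVec] at h1
  have h2 := congrArg (aeval T.A) hrs
  rw [map_add, map_mul _ r, Matrix.aeval_self_charpoly, mul_zero, zero_add, map_one, mul_comm] at h2
  rw [h2, Matrix.one_mulVec] at h1
  exact hinj v h1.symm

/-- Observability makes a symmetric Lyapunov solution injective. -/
lemma IsObservable.solvesQ_injective {T : RealTriplet ι} (h : T.IsObservable) {Q : Matrix ι ι ℝ}
    (hQ : T.SolvesQ Q) (hs : Qᵀ = Q) {v : ι → ℝ} (hv : Q *ᵥ v = 0) : v = 0 := by
  -- Pairing the Lyapunov equation with w ∈ ker Q on both sides gives (C w)² = 0, and then Q A w =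
  -- 0: ker Q is A-invariant and lies in ker C.
  have key : ∀ w, Q *ᵥ w = 0 → T.C ⬝ᵥ w = 0 ∧ Q *ᵥ (T.A *ᵥ w) = 0 := by
    intro w hw
    have h1 := congrArg (· *ᵥ w) hQ
    simp only [Matrix.add_mulVec, Matrix.vecMulVec_mulVec, ← Matrix.mulVec_mulVec, hw,
      Matrix.mulVec_zero, zero_add] at h1
    have h2 : w ⬝ᵥ (Q *ᵥ (T.A *ᵥ w)) = 0 := by
      rw [Matrix.dotProduct_mulVec, ← Matrix.mulVec_transpose, hs, hw, zero_dotProduct]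
    have h3 : T.C ⬝ᵥ w = 0 := by
      rw [h1] at h2
      simpa [dotProduct_comm] using h2
    exact ⟨h3, by rw [h1, h3]; simp⟩
  have hk : ∀ k : ℕ, Q *ᵥ ((T.A ^ k) *ᵥ v) = 0 := by
    intro k
    induction k with
    | zero => simpa using hv
    | succ k ih =>
      rw [pow_succ', ← Matrix.mulVec_mulVec]
      exact (key _ ih).2
  exact h v fun k => (key _ (hk k)).1

end RealTriplet

/-! ### Decay of the matrix exponential. -/

section Decay

open Filter Topology

variable {ι : Type} [Fintype ι] [DecidableEq ι]

lemma Matrix.map_ofReal_exp (A : Matrix ι ι ℝ) :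
    (NormedSpace.exp A).map Complex.ofReal = NormedSpace.exp (A.map Complex.ofReal) := by
  open scoped Norms.Operator in
  exact NormedSpace.map_exp (Complex.ofRealHom.mapMatrix (m := ι))
    (continuous_id.matrix_map Complex.continuous_ofReal) A

lemma Matrix.hasSum_exp_mulVec (A : Matrix ι ι ℂ) (v : ι → ℂ) :
    HasSum (fun n : ℕ => ((n.factorial : ℂ)⁻¹) • ((A ^ n) *ᵥ v)) (NormedSpace.exp A *ᵥ v) := by
  have h : HasSum (fun n : ℕ => ((n.factorial : ℂ)⁻¹) • A ^ n) (NormedSpace.exp A) := by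
    open scoped Norms.Operator in
    exact NormedSpace.exp_series_hasSum_exp' (𝕂 := ℂ) A
  have h2 := h.map (AddMonoidHom.mk' (fun M : Matrix ι ι ℂ => M *ᵥ v)
    (fun a b => Matrix.add_mulVec a b v)) (continuous_id.matrix_mulVec continuous_const)
  have h3 : (fun n : ℕ => ((n.factorial : ℂ)⁻¹) • ((A ^ n) *ᵥ v)) =
      (fun M : Matrix ι ι ℂ => M *ᵥ v) ∘ fun n => ((n.factorial : ℂ)⁻¹) • A ^ n := by
    ext1 n
    simp [Matrix.smul_mulVec]
  rw [h3]
  exact h2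

lemma Complex.tendsto_exp_neg_mul_mul_pow {μ : ℂ} (hμ : 0 < μ.re) (n : ℕ) :
    Tendsto (fun y : ℝ => Complex.exp (-(y * μ)) * (y : ℂ) ^ n) atTop (𝓝 0) := by
  rw [tendsto_zero_iff_norm_tendsto_zero]
  have h := (isLittleO_pow_exp_pos_mul_atTop n hμ).tendsto_div_nhds_zero
  have h2 := h.norm
  rw [norm_zero] at h2
  refine h2.congr fun y => ?_
  rw [norm_mul, Complex.norm_exp, norm_div, norm_pow, norm_pow, Complex.norm_real, Real.norm_eq_abs,
    Real.norm_eq_abs, Real.abs_exp, div_eq_mul_inv, ← Real.exp_neg, mul_comm]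
  simp [mul_comm]

/-- The vectors with decaying orbit form a subspace. It contains every generalized eigenspace,
because there the orbit is e^{-yμ} times a polynomial in y; and these eigenspaces span. -/
lemma Matrix.tendsto_exp_neg_smul_mulVec_complex (A : Matrix ι ι ℂ)
    (hA : ∀ z, Module.End.HasEigenvalue (Matrix.toLin' A) z → 0 < z.re) (v : ι → ℂ) :
    Tendsto (fun y : ℝ => NormedSpace.exp (-((y : ℂ) • A)) *ᵥ v) atTop (𝓝 0) := by
  let W : Submodule ℂ (ι → ℂ) :=
    { carrier := {v | Tendsto (fun y : ℝ => NormedSpace.exp (-((y : ℂ) • A)) *ᵥ v) atTop (𝓝 0)}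
      zero_mem' := by simp
      add_mem' := fun {a b} ha hb => by
        simpa [Matrix.mulVec_add] using Tendsto.add ha hb
      smul_mem' := fun c a ha => by
        simpa [Matrix.mulVec_smul] using Tendsto.const_smul ha c }
  suffices h : W = ⊤ by
    have : v ∈ W := h ▸ Submodule.mem_top
    exact this
  rw [eq_top_iff, ← Module.End.iSup_maxGenEigenspace_eq_top (Matrix.toLin' A), iSup_le_iff]
  intro μ u hu
  obtain ⟨k, hk⟩ := (Module.End.mem_maxGenEigenspace _ _ _).1 hu
  rcases eq_or_ne u 0 with rfl | hu0
  · exact W.zero_mem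
  have hμ : 0 < μ.re := by
    apply hA
    refine Module.End.hasEigenvalue_of_hasGenEigenvalue (k := k) ?_
    rw [Module.End.hasGenEigenvalue_iff, Submodule.ne_bot_iff]
    exact ⟨u, Module.End.mem_genEigenspace_nat.2 hk, hu0⟩
  set N : Matrix ι ι ℂ := A - μ • 1 with hN
  have hkN : (N ^ k) *ᵥ u = 0 := by
    have : (Matrix.toLin' A - μ • (1 : Module.End ℂ (ι → ℂ))) = Matrix.toLin' N := by
      rw [hN, map_sub, map_smul, Matrix.toLin'_one]; rfl
    rw [this, ← Matrix.toLin'_pow, Matrix.toLin'_apply] at hk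
    exact hk
  have hexp : ∀ y : ℝ, NormedSpace.exp (-((y : ℂ) • A)) *ᵥ u =
      ∑ n ∈ Finset.range k, (Complex.exp (-(y * μ)) * (y : ℂ) ^ n) •
        (((n.factorial : ℂ)⁻¹ * (-1) ^ n) • ((N ^ n) *ᵥ u)) := by
    intro y
    have h1 : -((y : ℂ) • A) = (-(y * μ)) • (1 : Matrix ι ι ℂ) + (-(y : ℂ)) • N := by
      rw [hN, smul_sub, smul_smul]
      module
    have h2 : NormedSpace.exp ((-(y * μ)) • (1 : Matrix ι ι ℂ)) = Complex.exp (-(y * μ)) • 1 := by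
      have := Matrix.exp_diagonal (fun _ : ι => (-(y * μ)))
      rw [Matrix.smul_one_eq_diagonal, Matrix.smul_one_eq_diagonal]
      rw [this]
      congr 1
      ext i
      rw [Pi.coe_exp, Complex.exp_eq_exp_ℂ]
    rw [h1, Matrix.exp_add_of_commute _ _ ((Commute.one_left _).smul_left _), h2,
      Matrix.smul_mul, Matrix.one_mul, Matrix.smul_mulVec]
    have h3 : NormedSpace.exp ((-(y : ℂ)) • N) *ᵥ u =
        ∑ n ∈ Finset.range k, ((n.factorial : ℂ)⁻¹) • ((((-(y : ℂ)) • N) ^ n) *ᵥ u) := by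
      refine (Matrix.hasSum_exp_mulVec _ u).unique (hasSum_sum_of_ne_finset_zero ?_)
      intro n hn
      rw [Finset.mem_range, not_lt] at hn
      obtain ⟨j, rfl⟩ := Nat.exists_eq_add_of_le' hn
      rw [_root_.smul_pow, pow_add N, Matrix.smul_mulVec, ← Matrix.mulVec_mulVec, hkN]
      simp
    rw [h3, Finset.smul_sum]
    refine Finset.sum_congr rfl fun n _ => ?_
    rw [_root_.smul_pow, Matrix.smul_mulVec, smul_smul, smul_smul, smul_smul, neg_pow]
    congr 1
    ring
  change Tendsto _ _ _
  simp_rw [hexp]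
  rw [← Finset.sum_const_zero (s := Finset.range k)]
  refine tendsto_finsetSum _ fun n _ => ?_
  simpa only [zero_smul] using (Complex.tendsto_exp_neg_mul_mul_pow hμ n).smul_const
    (((n.factorial : ℂ)⁻¹ * (-1) ^ n) • ((N ^ n) *ᵥ u))

end Decay
-- Positive semidefinite Lyapunov solutions.
namespace RealTriplet
open Filter Topology
variable {ι : Type} [Fintype ι] [DecidableEq ι]

lemma tendsto_exp_neg_smul_mulVec {T : RealTriplet ι} (h : ∀ z, T.IsEigenvalue z → 0 < z.re)
    (v : ι → ℝ) :
    Tendsto (fun y : ℝ => NormedSpace.exp (-(y • T.A)) *ᵥ v) atTop (𝓝 0) := by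
  have h1 := Matrix.tendsto_exp_neg_smul_mulVec_complex (T.A.map Complex.ofReal) h
    (fun i => (v i : ℂ))
  rw [tendsto_pi_nhds] at h1 ⊢
  intro i
  have h2 := (Complex.continuous_re.tendsto _).comp (h1 i)
  simp only [Pi.zero_apply, Complex.zero_re] at h2 ⊢
  refine h2.congr fun y => ?_
  have h3 : -((y : ℂ) • T.A.map Complex.ofReal) = (-(y • T.A)).map Complex.ofReal := by
    ext; simp
  rw [Function.comp_apply, h3, ← Matrix.map_ofReal_exp]
  simp [Matrix.mulVec, dotProduct]

lemma hasDerivAt_exp_neg_smul_mulVec (A : Matrix ι ι ℝ) (v : ι → ℝ) (y : ℝ) :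
    HasDerivAt (fun y : ℝ => NormedSpace.exp (-(y • A)) *ᵥ v)
      (-(A *ᵥ (NormedSpace.exp (-(y • A)) *ᵥ v))) y := by
  open scoped Matrix.Norms.Operator in
  have h : HasDerivAt (fun y : ℝ => NormedSpace.exp (y • (-A)))
      ((-A) * NormedSpace.exp (y • (-A))) y := hasDerivAt_exp_smul_const' (𝕂 := ℝ) (-A) y
  rw [hasDerivAt_pi]
  intro i
  let l : Matrix ι ι ℝ →ₗ[ℝ] ℝ :=
    { toFun := fun M => (M *ᵥ v) i
      map_add' := fun a b => by simp [Matrix.add_mulVec]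
      map_smul' := fun c a => by simp [Matrix.smul_mulVec] }
  open scoped Matrix.Norms.Operator in
  have h2 : HasDerivAt (fun y : ℝ => l (NormedSpace.exp (y • (-A))))
      (l ((-A) * NormedSpace.exp (y • (-A)))) y :=
    (LinearMap.toContinuousLinearMap l).hasFDerivAt.comp_hasDerivAt y h
  simpa [l, smul_neg, Matrix.mulVec_mulVec, Matrix.neg_mulVec] using h2

/-- The Lyapunov solution is positive semidefinite when the spectrum lies in the right half-plane. -/
lemma SolvesQ.dotProduct_nonneg {T : RealTriplet ι} (h : ∀ z, T.IsEigenvalue z → 0 < z.re)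
    {Q : Matrix ι ι ℝ} (hQ : T.SolvesQ Q) (v : ι → ℝ) : 0 ≤ v ⬝ᵥ (Q *ᵥ v) := by
  set e : ℝ → ι → ℝ := fun y => NormedSpace.exp (-(y • T.A)) *ᵥ v with he
  -- This is the differential form of Q = ∫₀^∞ e^{-Aᵀy} Cᵀ C e^{-Ay} dy: along the flow the
  -- quadratic form decreases to 0, so it starts nonnegative.
  have hderiv : ∀ y, HasDerivAt (fun y => e y ⬝ᵥ (Q *ᵥ e y)) (-(T.C ⬝ᵥ e y) ^ 2) y := by
    intro y
    have hd := hasDerivAt_exp_neg_smul_mulVec T.A v y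
    rw [hasDerivAt_pi] at hd
    have hd2 : HasDerivAt (fun y => Q *ᵥ e y) (-(Q *ᵥ (T.A *ᵥ e y))) y := by
      rw [hasDerivAt_pi]
      intro i
      have := HasDerivAt.fun_sum (u := Finset.univ) fun j _ => (hd j).const_mul (Q i j)
      rw [← Matrix.mulVec_neg]
      exact this
    rw [hasDerivAt_pi] at hd2
    have hd3 := HasDerivAt.fun_sum (u := Finset.univ) fun j _ => (hd j).mul (hd2 j)
    refine hd3.congr_deriv ?_
    rw [Finset.sum_add_distrib]
    change (-(T.A *ᵥ e y)) ⬝ᵥ (Q *ᵥ e y) + e y ⬝ᵥ (-(Q *ᵥ (T.A *ᵥ e y))) = _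
    have h1 := congrArg (fun M => e y ⬝ᵥ (M *ᵥ e y)) hQ
    simp only [Matrix.add_mulVec, dotProduct_add, Matrix.vecMulVec_mulVec,
      ← Matrix.mulVec_mulVec] at h1
    rw [Matrix.dotProduct_mulVec, Matrix.vecMul_transpose] at h1
    simp only [neg_dotProduct, dotProduct_neg]
    simp only [op_smul_eq_smul, dotProduct_smul, smul_eq_mul, dotProduct_comm (e y) T.C] at h1
    linear_combination -h1
  have hanti : Antitone (fun y => e y ⬝ᵥ (Q *ᵥ e y)) :=
    antitone_of_hasDerivAt_nonpos hderiv fun y => by simpa using sq_nonneg _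
  have hlim : Tendsto (fun y => e y ⬝ᵥ (Q *ᵥ e y)) atTop (𝓝 0) := by
    have h1 := tendsto_exp_neg_smul_mulVec h v
    have hc : Continuous fun w : ι → ℝ => w ⬝ᵥ (Q *ᵥ w) := by fun_prop
    have h2 := (hc.tendsto 0).comp h1
    rw [zero_dotProduct] at h2
    exact h2
  have h0 := hanti.le_of_tendsto hlim 0
  simpa [he] using h0

end RealTriplet

/-! ### Intertwining relations pass to exponentials. -/

section ExpIntertwine

variable {ι κ : Type} [Fintype ι] [DecidableEq ι] [Fintype κ] [DecidableEq κ]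

lemma Matrix.exp_mul_eq_mul_exp {A : Matrix κ κ ℝ} {A' : Matrix ι ι ℝ} {X : Matrix κ ι ℝ}
    (h : A * X = X * A') : NormedSpace.exp A * X = X * NormedSpace.exp A' := by
  have hA : HasSum (fun n : ℕ => ((n.factorial : ℝ)⁻¹) • A ^ n) (NormedSpace.exp A) := by
    open scoped Matrix.Norms.Operator in
    exact NormedSpace.exp_series_hasSum_exp' (𝕂 := ℝ) A
  have hA' : HasSum (fun n : ℕ => ((n.factorial : ℝ)⁻¹) • A' ^ n) (NormedSpace.exp A') := by
    open scoped Matrix.Norms.Operator in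
    exact NormedSpace.exp_series_hasSum_exp' (𝕂 := ℝ) A'
  let φ : Matrix κ κ ℝ →+ Matrix κ ι ℝ :=
    AddMonoidHom.mk' (fun M => M * X) (fun a b => Matrix.add_mul a b X)
  let ψ : Matrix ι ι ℝ →+ Matrix κ ι ℝ :=
    AddMonoidHom.mk' (fun M => X * M) (fun a b => Matrix.mul_add X a b)
  have h1 := hA.map φ (continuous_id.matrix_mul continuous_const)
  have h2 := hA'.map ψ (continuous_const.matrix_mul continuous_id)
  have h3 : (φ ∘ fun n : ℕ => ((n.factorial : ℝ)⁻¹) • A ^ n) =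
      ψ ∘ fun n : ℕ => ((n.factorial : ℝ)⁻¹) • A' ^ n := by
    ext1 n
    have := Matrix.aeval_mul_eq_mul_aeval h (Polynomial.X ^ n)
    simp only [map_pow, aeval_X] at this
    simp [φ, ψ, this]
  rw [h3] at h1
  exact h1.unique h2

end ExpIntertwine

/-! ### Invertibility of `F`, and similarity of triplets. -/

namespace RealTriplet

variable {ι κ : Type} [Fintype ι] [DecidableEq ι] [Fintype κ] [DecidableEq κ]

/-- For a semidefinite Q, vanishing of the form at v means Q v = 0, which observability excludes for
v ≠ 0. -/
lemma IsObservable.solvesQ_pos {T : RealTriplet ι} (hT : T.IsObservable)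
    (h : ∀ z, T.IsEigenvalue z → 0 < z.re) {Q : Matrix ι ι ℝ} (hQ : T.SolvesQ Q)
    {v : ι → ℝ} (hv : v ≠ 0) : 0 < v ⬝ᵥ (Q *ᵥ v) := by
  have hs : Qᵀ = Q := (spectrumSplit_of_pos h).solvesQ_transpose hQ
  refine (hQ.dotProduct_nonneg h v).lt_of_ne fun h0 => hv ?_
  have hps : Q.PosSemidef := by
    refine Matrix.PosSemidef.of_dotProduct_mulVec_nonneg hs fun x => ?_
    simpa using hQ.dotProduct_nonneg h x
  refine hT.solvesQ_injective hQ hs ?_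
  refine (hps.dotProduct_mulVec_zero_iff v).1 ?_
  simpa using h0.symm

/-- The exponent `2 A x - 8 A³ t`. -/
def phase (T : RealTriplet ι) (x t : ℝ) : Matrix ι ι ℝ := (2 * x) • T.A - (8 * t) • T.A ^ 3

lemma F_eq (T : RealTriplet ι) (Q N : Matrix ι ι ℝ) (x t : ℝ) :
    T.F Q N x t = NormedSpace.exp (T.phase x t)ᵀ + Q * NormedSpace.exp (-T.phase x t) * N := by
  rw [F, phase, neg_sub, neg_add_eq_sub]
  simp

lemma exp_mul_exp_neg (M : Matrix ι ι ℝ) : NormedSpace.exp M * NormedSpace.exp (-M) = 1 := by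
  rw [← Matrix.exp_add_of_commute _ _ (Commute.neg_right (Commute.refl M))]
  simp

lemma exp_neg_mul_exp (M : Matrix ι ι ℝ) : NormedSpace.exp (-M) * NormedSpace.exp M = 1 := by
  simpa using exp_mul_exp_neg (-M)

lemma isUnit_of_mulVec_eq_zero {M : Matrix ι ι ℝ} (h : ∀ v, M *ᵥ v = 0 → v = 0) : IsUnit M := by
  rw [← Matrix.mulVec_injective_iff_isUnit]
  intro v w hvw
  rw [← sub_eq_zero]
  apply h
  rw [Matrix.mulVec_sub, sub_eq_zero]
  exact hvw

/-- For positive definite `Q` and `N`, the matrix `F(x,t)` is invertible. -/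
lemma isUnit_F_of_pos (T : RealTriplet ι) {Q N : Matrix ι ι ℝ}
    (hQ : ∀ v ≠ 0, 0 < v ⬝ᵥ (Q *ᵥ v)) (hN : ∀ v ≠ 0, 0 < v ⬝ᵥ (N *ᵥ v)) (x t : ℝ) :
    IsUnit (T.F Q N x t) := by
  refine isUnit_of_mulVec_eq_zero fun v hv => ?_
  by_contra hv0
  rw [F_eq] at hv
  set M := T.phase x t
  set w := NormedSpace.exp (-M) *ᵥ (N *ᵥ v) with hw
  have h1 : v + NormedSpace.exp (-Mᵀ) *ᵥ (Q *ᵥ w) = 0 := by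
    have := congrArg (NormedSpace.exp (-Mᵀ) *ᵥ ·) hv
    simpa only [Matrix.add_mulVec, Matrix.mulVec_add, Matrix.mulVec_mulVec, ← Matrix.mul_assoc,
      exp_neg_mul_exp, Matrix.one_mulVec, Matrix.mulVec_zero, hw] using this
  -- With w = e^{-M} N v, pairing with N v gives v · N v + w · Q w = 0, a positive term plus a
  -- nonnegative one.
  have h2 := congrArg ((N *ᵥ v) ⬝ᵥ ·) h1
  simp only [dotProduct_add, dotProduct_zero] at h2
  rw [← Matrix.transpose_neg, Matrix.exp_transpose, Matrix.dotProduct_mulVec, Matrix.vecMul_transpose,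
    ← hw, dotProduct_comm] at h2
  have h3 := hN v hv0
  rcases eq_or_ne w 0 with h0 | h0
  · simp [h0] at h2
    linarith
  · have := hQ w h0
    linarith

/-- The potential attached to given solutions of the Lyapunov equations. -/
noncomputable def potential (T : RealTriplet ι) (Q N : Matrix ι ι ℝ) (x t : ℝ) : ℝ :=
  -2 * (T.B ⬝ᵥ ((T.F Q N x t)⁻¹ *ᵥ T.C))

lemma SpectrumSplit.leadsTo {T : RealTriplet ι} (h : T.SpectrumSplit) {Q N : Matrix ι ι ℝ}
    (hQ : T.SolvesQ Q) (hN : T.SolvesN N) {u : ℝ → ℝ → ℝ}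
    (hF : ∀ x t, IsUnit (T.F Q N x t) ∧ u x t = T.potential Q N x t) : T.LeadsTo u :=
  ⟨Q, N, ⟨hQ, fun _ hQ' => h.solvesQ_unique hQ hQ'⟩,
    ⟨hN, fun _ hN' => h.dual.solvesQ_unique ((solvesN_iff_dual _ _).1 hN)
      ((solvesN_iff_dual _ _).1 hN')⟩, hF⟩

/-- Similarity of triplets, implemented by `S` with inverse `S'`. -/
structure IsSimilar (T : RealTriplet ι) (T' : RealTriplet κ) (S : Matrix κ ι ℝ)
    (S' : Matrix ι κ ℝ) : Prop where
  mul_inv : S * S' = 1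
  inv_mul : S' * S = 1
  mul_A : S * T.A = T'.A * S
  mulVec_B : S *ᵥ T.B = T'.B
  vecMul_C : T'.C ᵥ* S = T.C

namespace IsSimilar

variable {T : RealTriplet ι} {T' : RealTriplet κ} {S : Matrix κ ι ℝ} {S' : Matrix ι κ ℝ}

lemma of_linearEquiv (L : (ι → ℝ) ≃ₗ[ℝ] (κ → ℝ)) (hA : ∀ v, L (T.A *ᵥ v) = T'.A *ᵥ L v)
    (hB : L T.B = T'.B) (hC : ∀ v, T'.C ⬝ᵥ L v = T.C ⬝ᵥ v) :
    IsSimilar T T' (LinearMap.toMatrix' L.toLinearMap) (LinearMap.toMatrix' L.symm.toLinearMap) where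
  mul_inv := by
    rw [← LinearMap.toMatrix'_comp, LinearEquiv.comp_coe, LinearEquiv.symm_trans_self]
    simp
  inv_mul := by
    rw [← LinearMap.toMatrix'_comp, LinearEquiv.comp_coe, LinearEquiv.self_trans_symm]
    simp
  mul_A := by
    refine Matrix.mulVec_injective (funext fun v => ?_)
    simp only [← Matrix.mulVec_mulVec, LinearMap.toMatrix'_mulVec, LinearEquiv.coe_coe, hA]
  mulVec_B := by
    simp only [LinearMap.toMatrix'_mulVec, LinearEquiv.coe_coe, hB]
  vecMul_C := by
    refine dotProduct_eq _ _ fun v => ?_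
    rw [← Matrix.dotProduct_mulVec]
    simp only [LinearMap.toMatrix'_mulVec, LinearEquiv.coe_coe, hC]

lemma inv_mul_A (h : IsSimilar T T' S S') : S' * T'.A = T.A * S' := by
  calc S' * T'.A = S' * (T'.A * (S * S')) := by rw [h.mul_inv, Matrix.mul_one]
    _ = S' * (S * T.A) * S' := by rw [h.mul_A]; simp only [Matrix.mul_assoc]
    _ = T.A * S' := by rw [← Matrix.mul_assoc S', h.inv_mul, Matrix.one_mul]

lemma symm (h : IsSimilar T T' S S') : IsSimilar T' T S' S where
  mul_inv := h.inv_mul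
  inv_mul := h.mul_inv
  mul_A := h.inv_mul_A
  mulVec_B := by rw [← h.mulVec_B, Matrix.mulVec_mulVec, h.inv_mul, Matrix.one_mulVec]
  vecMul_C := by rw [← h.vecMul_C, Matrix.vecMul_vecMul, h.mul_inv, Matrix.vecMul_one]

lemma dual (h : IsSimilar T T' S S') : IsSimilar T.dual T'.dual S'ᵀ Sᵀ where
  mul_inv := by rw [← Matrix.transpose_mul, h.mul_inv, Matrix.transpose_one]
  inv_mul := by rw [← Matrix.transpose_mul, h.inv_mul, Matrix.transpose_one]
  mul_A := by
    simp only [RealTriplet.dual]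
    rw [← Matrix.transpose_mul, ← Matrix.transpose_mul, h.inv_mul_A]
  mulVec_B := by
    rw [Matrix.mulVec_transpose]
    exact h.symm.vecMul_C
  vecMul_C := by
    rw [Matrix.vecMul_transpose]
    exact h.symm.mulVec_B

lemma pow_mul (h : IsSimilar T T' S S') (k : ℕ) : T'.A ^ k * S = S * T.A ^ k := by
  simpa using Matrix.aeval_mul_eq_mul_aeval h.mul_A.symm (X ^ k)

/-- The characteristic polynomial of `T'.A` annihilates `T.A`, by the intertwining relation. -/
lemma isEigenvalue (h : IsSimilar T T' S S') {z : ℂ} (hz : T.IsEigenvalue z) :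
    T'.IsEigenvalue z := by
  rw [isEigenvalue_iff_aeval_charpoly]
  apply hz.aeval_eq_zero
  have := Matrix.aeval_mul_eq_mul_aeval h.mul_A.symm T'.A.charpoly
  rw [Matrix.aeval_self_charpoly, Matrix.zero_mul] at this
  rw [← Matrix.one_mul (aeval T.A T'.A.charpoly), ← h.inv_mul, Matrix.mul_assoc, ← this,
    Matrix.mul_zero]

lemma isObservable (h : IsSimilar T T' S S') (hT : T.IsObservable) : T'.IsObservable := by
  intro v hv
  have : S' *ᵥ v = 0 := by
    apply hT
    intro k
    rw [← h.vecMul_C, ← Matrix.dotProduct_mulVec, Matrix.mulVec_mulVec, Matrix.mulVec_mulVec,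
      ← h.pow_mul, Matrix.mul_assoc, h.mul_inv, Matrix.mul_one, hv]
  have h2 := congrArg (S *ᵥ ·) this
  simpa [h.mul_inv] using h2

lemma isMinimal (h : IsSimilar T T' S S') (hT : T.IsMinimal) : T'.IsMinimal :=
  ⟨h.isObservable hT.1, h.dual.isObservable hT.2⟩

lemma isAdmissible (h : IsSimilar T T' S S') (hT : T.IsAdmissible) : T'.IsAdmissible where
  minimal := h.isMinimal hT.minimal
  re_ne_zero z hz := hT.re_ne_zero z (h.symm.isEigenvalue hz)
  not_symm z w hz hw := hT.not_symm z w (h.symm.isEigenvalue hz) (h.symm.isEigenvalue hw)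

lemma solvesQ (h : IsSimilar T T' S S') {Q : Matrix κ κ ℝ} (hQ : T'.SolvesQ Q) :
    T.SolvesQ (Sᵀ * Q * S) := by
  have h1 : T.Aᵀ * Sᵀ = Sᵀ * T'.Aᵀ := by
    rw [← Matrix.transpose_mul, ← Matrix.transpose_mul, h.mul_A]
  rw [SolvesQ]
  calc T.Aᵀ * (Sᵀ * Q * S) + Sᵀ * Q * S * T.A
      = Sᵀ * (T'.Aᵀ * Q + Q * T'.A) * S := by
        rw [Matrix.mul_assoc _ S, h.mul_A, ← Matrix.mul_assoc, ← Matrix.mul_assoc, h1]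
        simp only [Matrix.mul_add, Matrix.add_mul, Matrix.mul_assoc]
    _ = _ := by
        rw [hQ, Matrix.mul_vecMulVec, Matrix.vecMulVec_mul, Matrix.mulVec_transpose, h.vecMul_C]

lemma solvesN (h : IsSimilar T T' S S') {N : Matrix κ κ ℝ} (hN : T'.SolvesN N) :
    T.SolvesN (S' * N * S'ᵀ) := by
  rw [solvesN_iff_dual] at *
  simpa using h.dual.solvesQ hN

lemma phase_mul (h : IsSimilar T T' S S') (x t : ℝ) : T'.phase x t * S = S * T.phase x t := by
  simp only [phase, Matrix.sub_mul, Matrix.mul_sub, Matrix.smul_mul, Matrix.mul_smul, h.pow_mul,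
    h.mul_A]

lemma F_eq (h : IsSimilar T T' S S') (Q N : Matrix κ κ ℝ) (x t : ℝ) :
    T.F (Sᵀ * Q * S) (S' * N * S'ᵀ) x t = Sᵀ * T'.F Q N x t * S'ᵀ := by
  have hinv : Sᵀ * S'ᵀ = 1 := h.dual.inv_mul
  have h1 : NormedSpace.exp (T.phase x t)ᵀ * Sᵀ = Sᵀ * NormedSpace.exp (T'.phase x t)ᵀ := by
    apply Matrix.exp_mul_eq_mul_exp
    rw [← Matrix.transpose_mul, ← Matrix.transpose_mul, h.phase_mul]
  have h2 : NormedSpace.exp (-T'.phase x t) * S = S * NormedSpace.exp (-T.phase x t) := by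
    apply Matrix.exp_mul_eq_mul_exp
    rw [Matrix.neg_mul, Matrix.mul_neg, h.phase_mul]
  rw [RealTriplet.F_eq, RealTriplet.F_eq, Matrix.mul_add, Matrix.add_mul, ← h1, Matrix.mul_assoc _ Sᵀ,
    hinv, Matrix.mul_one]
  congr 1
  calc Sᵀ * Q * S * NormedSpace.exp (-T.phase x t) * (S' * N * S'ᵀ)
      = Sᵀ * Q * (S * NormedSpace.exp (-T.phase x t)) * (S' * N * S'ᵀ) := by
        simp only [Matrix.mul_assoc]
    _ = Sᵀ * Q * NormedSpace.exp (-T'.phase x t) * (S * S') * (N * S'ᵀ) := by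
        rw [← h2]; simp only [Matrix.mul_assoc]
    _ = _ := by rw [h.mul_inv, Matrix.mul_one]; simp only [Matrix.mul_assoc]

/-- Since S'ᵀ is the inverse of Sᵀ, `F` for T is a conjugate of `F` for T'. The factors S and S' are
absorbed by C and B, leaving the scalar Bᵀ F⁻¹ Cᵀ unchanged. -/
lemma leadsTo (h : IsSimilar T T' S S') (hT : T.SpectrumSplit) {u : ℝ → ℝ → ℝ}
    (hu : T'.LeadsTo u) : T.LeadsTo u := by
  obtain ⟨Q, N, ⟨hQ, -⟩, ⟨hN, -⟩, hF⟩ := hu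
  refine hT.leadsTo (h.solvesQ hQ) (h.solvesN hN) fun x t => ?_
  obtain ⟨hU, hu⟩ := hF x t
  have hright : T.F (Sᵀ * Q * S) (S' * N * S'ᵀ) x t * (Sᵀ * (T'.F Q N x t)⁻¹ * S'ᵀ) = 1 := by
    rw [h.F_eq]
    calc Sᵀ * T'.F Q N x t * S'ᵀ * (Sᵀ * (T'.F Q N x t)⁻¹ * S'ᵀ)
        = Sᵀ * T'.F Q N x t * (S'ᵀ * Sᵀ) * (T'.F Q N x t)⁻¹ * S'ᵀ := by
          simp only [Matrix.mul_assoc]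
      _ = Sᵀ * (T'.F Q N x t * (T'.F Q N x t)⁻¹) * S'ᵀ := by
          rw [h.dual.mul_inv, Matrix.mul_one]; simp only [Matrix.mul_assoc]
      _ = 1 := by
          rw [Matrix.mul_nonsing_inv _ ((Matrix.isUnit_iff_isUnit_det _).1 hU), Matrix.mul_one,
            h.dual.inv_mul]
  refine ⟨IsUnit.of_mul_eq_one _ hright, ?_⟩
  rw [hu, potential, Matrix.inv_eq_right_inv hright, ← h.mulVec_B, ← Matrix.mulVec_mulVec,
    ← Matrix.mulVec_mulVec, Matrix.dotProduct_mulVec T.B, Matrix.vecMul_transpose]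
  congr 4
  exact h.dual.mulVec_B.symm

end IsSimilar

end RealTriplet

/-! ### Direct sums and reflection of a summand. -/

section Blocks

variable {ι κ : Type} [Fintype ι] [DecidableEq ι] [Fintype κ] [DecidableEq κ]

/-- The inclusions of the two summands intertwine the blocks with the whole matrix, hence also their
exponentials; this determines both block columns. -/
lemma Matrix.exp_fromBlocks_diagonal (A : Matrix ι ι ℝ) (D : Matrix κ κ ℝ) :
    NormedSpace.exp (fromBlocks A 0 0 D) =
      fromBlocks (NormedSpace.exp A) 0 0 (NormedSpace.exp D) := by
  have h1 : NormedSpace.exp (fromBlocks A 0 0 D) * fromRows (1 : Matrix ι ι ℝ) (0 : Matrix κ ι ℝ) =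
      fromRows (1 : Matrix ι ι ℝ) (0 : Matrix κ ι ℝ) * NormedSpace.exp A := by
    apply exp_mul_eq_mul_exp
    rw [fromBlocks_mul_fromRows, fromRows_mul]
    simp
  have h2 : NormedSpace.exp (fromBlocks A 0 0 D) * fromRows (0 : Matrix ι κ ℝ) (1 : Matrix κ κ ℝ) =
      fromRows (0 : Matrix ι κ ℝ) (1 : Matrix κ κ ℝ) * NormedSpace.exp D := by
    apply exp_mul_eq_mul_exp
    rw [fromBlocks_mul_fromRows, fromRows_mul]
    simp
  obtain ⟨a, b, c, d, h⟩ : ∃ a b c d, NormedSpace.exp (fromBlocks A 0 0 D) = fromBlocks a b c d :=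
    ⟨_, _, _, _, (fromBlocks_toBlocks _).symm⟩
  rw [h] at h1 h2 ⊢
  rw [fromBlocks_mul_fromRows, fromRows_mul] at h1 h2
  obtain ⟨ha, hc⟩ := fromRows_inj.eq_iff.1 h1
  obtain ⟨hb, hd⟩ := fromRows_inj.eq_iff.1 h2
  simp only [Matrix.mul_one, Matrix.mul_zero, add_zero, zero_add, Matrix.one_mul,
    Matrix.zero_mul] at ha hb hc hd
  rw [ha, hb, hc, hd]

lemma Matrix.vecMulVec_sumElim (a c : ι → ℝ) (b d : κ → ℝ) :
    vecMulVec (Sum.elim a b) (Sum.elim c d) =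
      fromBlocks (vecMulVec a c) (vecMulVec a d) (vecMulVec b c) (vecMulVec b d) := by
  ext (i | i) (j | j) <;> rfl

end Blocks

namespace RealTriplet

variable {ι κ : Type} [Fintype ι] [DecidableEq ι] [Fintype κ] [DecidableEq κ]

/-- The direct sum of two triplets. -/
def sum (T : RealTriplet ι) (S : RealTriplet κ) : RealTriplet (ι ⊕ κ) where
  A := Matrix.fromBlocks T.A 0 0 S.A
  B := Sum.elim T.B S.B
  C := Sum.elim T.C S.C

/-- The triplet obtained from `T.sum S` by reflecting the spectrum of `S`. Here `Q`, `P` stand for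
the upper right block and the inverse of the lower right block of the first Lyapunov solution,
and `N`, `R` for those of the second one. -/
def flip (T : RealTriplet ι) (S : RealTriplet κ) (Q N : Matrix ι κ ℝ) (P R : Matrix κ κ ℝ) :
    RealTriplet (ι ⊕ κ) where
  A := Matrix.fromBlocks T.A 0 0 (-S.Aᵀ)
  B := Sum.elim (T.B - N *ᵥ (R *ᵥ S.B)) (R *ᵥ S.B)
  C := Sum.elim (T.C - Q *ᵥ (P *ᵥ S.C)) (P *ᵥ S.C)

/-- The Lyapunov solution of the reflected triplet. -/
def flipGram (Q₁ : Matrix ι ι ℝ) (Q : Matrix ι κ ℝ) (P : Matrix κ κ ℝ) :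
    Matrix (ι ⊕ κ) (ι ⊕ κ) ℝ :=
  Matrix.fromBlocks (Q₁ - Q * P * Qᵀ) (Q * P) (P * Qᵀ) (-P)

lemma dual_sum (T : RealTriplet ι) (S : RealTriplet κ) : (T.sum S).dual = T.dual.sum S.dual := by
  simp [dual, sum, Matrix.fromBlocks_transpose]

lemma dual_flip (T : RealTriplet ι) (S : RealTriplet κ) (Q N : Matrix ι κ ℝ) (P R : Matrix κ κ ℝ) :
    (T.flip S Q N P R).dual = T.dual.flip S.dual N Q R P := by
  simp [dual, flip, Matrix.fromBlocks_transpose]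

lemma solvesQ_sum_iff (T : RealTriplet ι) (S : RealTriplet κ) {Q₁ : Matrix ι ι ℝ}
    {Q : Matrix ι κ ℝ} {Q₄ : Matrix κ κ ℝ} :
    (T.sum S).SolvesQ (Matrix.fromBlocks Q₁ Q Qᵀ Q₄) ↔
      T.SolvesQ Q₁ ∧ T.Aᵀ * Q + Q * S.A = Matrix.vecMulVec T.C S.C ∧
      S.Aᵀ * Qᵀ + Qᵀ * T.A = Matrix.vecMulVec S.C T.C ∧ S.SolvesQ Q₄ := by
  simp only [SolvesQ, sum, Matrix.fromBlocks_transpose, Matrix.fromBlocks_multiply,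
    Matrix.fromBlocks_add, Matrix.vecMulVec_sumElim, Matrix.fromBlocks_inj]
  simp

/-- With P = Q₄⁻¹ the matrix `flipGram` is a partial inverse: if the original Gram matrix sends (v₁,
v₂) to (y₁, y₂), it sends (v₁, y₂) to (y₁, -v₂). Each block of the new equation follows from the
four old ones after multiplying by P. -/
lemma solvesQ_flip {T : RealTriplet ι} {S : RealTriplet κ} {Q₁ : Matrix ι ι ℝ}
    {Q : Matrix ι κ ℝ} {Q₄ : Matrix κ κ ℝ} {P : Matrix κ κ ℝ}
    (hQ : (T.sum S).SolvesQ (Matrix.fromBlocks Q₁ Q Qᵀ Q₄)) (hP : Pᵀ = P) (hQP : Q₄ * P = 1)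
    (hPQ : P * Q₄ = 1) (N : Matrix ι κ ℝ) (R : Matrix κ κ ℝ) :
    (T.flip S Q N P R).SolvesQ (flipGram Q₁ Q P) := by
  obtain ⟨h11, h12, h21, h22⟩ := (solvesQ_sum_iff T S).1 hQ
  have hQP' : ∀ {α : Type} (X : Matrix κ α ℝ), Q₄ * (P * X) = X := fun X => by
    rw [← Matrix.mul_assoc, hQP, Matrix.one_mul]
  have hPQ' : ∀ {α : Type} (X : Matrix κ α ℝ), P * (Q₄ * X) = X := fun X => by
    rw [← Matrix.mul_assoc, hPQ, Matrix.one_mul]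
  have hC : P *ᵥ S.C = S.C ᵥ* P := by rw [← Matrix.vecMul_transpose, hP]
  have e1 : ∀ {α β : Type} (a : α → ℝ) (b c : β → ℝ), Matrix.vecMulVec a (b - c) =
      Matrix.vecMulVec a b - Matrix.vecMulVec a c := fun a b c => by
    ext; simp [Matrix.vecMulVec_apply, mul_sub]
  have e2 : ∀ {α β : Type} (b c : α → ℝ) (a : β → ℝ), Matrix.vecMulVec (b - c) a =
      Matrix.vecMulVec b a - Matrix.vecMulVec c a := fun b c a => by
    ext; simp [Matrix.vecMulVec_apply, sub_mul]
  have k22 : Matrix.vecMulVec (P *ᵥ S.C) (P *ᵥ S.C) = P * (S.Aᵀ * Q₄ + Q₄ * S.A) * P := by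
    rw [h22, Matrix.mul_vecMulVec, Matrix.vecMulVec_mul, ← hC]
  have k12 : Matrix.vecMulVec T.C (P *ᵥ S.C) = (T.Aᵀ * Q + Q * S.A) * P := by
    rw [h12, Matrix.vecMulVec_mul, ← hC]
  have k21 : Matrix.vecMulVec (P *ᵥ S.C) T.C = P * (S.Aᵀ * Qᵀ + Qᵀ * T.A) := by
    rw [h21, Matrix.mul_vecMulVec]
  have l1 : ∀ {α : Type} (a : α → ℝ), Matrix.vecMulVec (Q *ᵥ (P *ᵥ S.C)) a =
      Q * Matrix.vecMulVec (P *ᵥ S.C) a := fun a => by rw [Matrix.mul_vecMulVec]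
  have l2 : ∀ {α : Type} (a : α → ℝ), Matrix.vecMulVec a (Q *ᵥ (P *ᵥ S.C)) =
      Matrix.vecMulVec a (P *ᵥ S.C) * Qᵀ := fun a => by
    rw [Matrix.vecMulVec_mul, Matrix.vecMul_transpose]
  rw [SolvesQ] at h11
  simp only [SolvesQ, flip, flipGram, Matrix.fromBlocks_transpose, Matrix.fromBlocks_multiply,
    Matrix.fromBlocks_add, Matrix.vecMulVec_sumElim, Matrix.fromBlocks_inj]
  refine ⟨?_, ?_, ?_, ?_⟩
  · simp only [e1, e2, l1, l2, k22, k12, k21, ← h11]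
    simp only [Matrix.mul_add, Matrix.add_mul, Matrix.mul_sub, Matrix.sub_mul, Matrix.mul_assoc, hQP',
      hPQ', Matrix.transpose_zero, Matrix.zero_mul, Matrix.mul_zero, add_zero]
    abel
  · simp only [e2, l1, k22, k12]
    simp only [Matrix.mul_add, Matrix.add_mul, Matrix.mul_assoc, hQP, Matrix.mul_neg,
      hPQ', Matrix.transpose_zero, Matrix.zero_mul, Matrix.mul_zero, Matrix.mul_one]
    abel
  · simp only [e1, l2, k22, k21]
    simp only [Matrix.mul_add, Matrix.add_mul, Matrix.mul_assoc, hQP', Matrix.neg_mul,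
      hPQ', Matrix.transpose_zero, Matrix.zero_mul, Matrix.mul_zero, zero_add, add_zero,
      Matrix.transpose_neg, Matrix.transpose_transpose]
    abel
  · simp only [k22]
    simp only [Matrix.mul_add, Matrix.add_mul, Matrix.mul_assoc, hQP, Matrix.neg_mul, Matrix.mul_neg,
      hPQ', Matrix.transpose_zero, Matrix.zero_mul, Matrix.mul_zero, zero_add,
      Matrix.transpose_neg, Matrix.transpose_transpose, neg_neg, Matrix.mul_one]
    abel

lemma phase_sum (T : RealTriplet ι) (S : RealTriplet κ) (x t : ℝ) :
    (T.sum S).phase x t = Matrix.fromBlocks (T.phase x t) 0 0 (S.phase x t) := by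
  have h : (T.sum S).A ^ 3 = Matrix.fromBlocks (T.A ^ 3) 0 0 (S.A ^ 3) := by
    simp [sum, pow_succ, Matrix.fromBlocks_multiply]
  rw [phase, h]
  simp [phase, sum, Matrix.fromBlocks_smul, sub_eq_add_neg, Matrix.fromBlocks_neg,
    Matrix.fromBlocks_add]

lemma phase_flip (T : RealTriplet ι) (S : RealTriplet κ) (Q N : Matrix ι κ ℝ) (P R : Matrix κ κ ℝ)
    (x t : ℝ) :
    (T.flip S Q N P R).phase x t = Matrix.fromBlocks (T.phase x t) 0 0 (-(S.phase x t)ᵀ) := by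
  have h := phase_sum T ⟨-S.Aᵀ, S.B, S.C⟩ x t
  have h2 : (⟨-S.Aᵀ, S.B, S.C⟩ : RealTriplet κ).phase x t = -(S.phase x t)ᵀ := by
    simp [phase, Odd.neg_pow (by decide : Odd 3)]
    abel
  rw [← h2, ← h]
  rfl

/-- Here v' = (v₁, Nᵀv₁ + N₄v₂), the variables exchanged by the partial inversion of the second
Lyapunov solution. The case s = 0 transfers invertibility, the case s = 1 the potential. -/
lemma F_mulVec_flip {T : RealTriplet ι} {S : RealTriplet κ} {Q₁ N₁ : Matrix ι ι ℝ}
    {Q N : Matrix ι κ ℝ} {Q₄ N₄ P R : Matrix κ κ ℝ} (hPQ : P * Q₄ = 1) (hR : Rᵀ = R)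
    (hRN : R * N₄ = 1) {x t s : ℝ} {v : ι ⊕ κ → ℝ}
    (hv : (T.sum S).F (Matrix.fromBlocks Q₁ Q Qᵀ Q₄) (Matrix.fromBlocks N₁ N Nᵀ N₄) x t *ᵥ v =
      s • (T.sum S).C) :
    ∃ v' : ι ⊕ κ → ℝ, (T.flip S Q N P R).F (flipGram Q₁ Q P) (flipGram N₁ N R) x t *ᵥ v' =
        s • (T.flip S Q N P R).C ∧
      (T.flip S Q N P R).B ⬝ᵥ v' = (T.sum S).B ⬝ᵥ v ∧ (v' = 0 → v = 0) := by
  obtain ⟨v₁, v₂, rfl⟩ : ∃ v₁ v₂, v = Sum.elim v₁ v₂ := ⟨_, _, (Sum.elim_comp_inl_inr v).symm⟩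
  set b := Nᵀ *ᵥ v₁ + N₄ *ᵥ v₂ with hb
  have hRb : R *ᵥ b = R *ᵥ (Nᵀ *ᵥ v₁) + v₂ := by
    rw [hb, Matrix.mulVec_add, Matrix.mulVec_mulVec v₂, hRN, Matrix.one_mulVec]
  have hNv : flipGram N₁ N R *ᵥ Sum.elim v₁ b = Sum.elim (N₁ *ᵥ v₁ + N *ᵥ v₂) (-v₂) := by
    rw [flipGram, Matrix.fromBlocks_mulVec]
    simp only [Sum.elim_comp_inl, Sum.elim_comp_inr, Matrix.sub_mulVec, Matrix.neg_mulVec,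
      ← Matrix.mulVec_mulVec, hRb, Matrix.mulVec_add]
    congr 1 <;> abel
  set H₁ := T.phase x t
  set H₂ := S.phase x t
  set w₁ := NormedSpace.exp (-H₁) *ᵥ (N₁ *ᵥ v₁ + N *ᵥ v₂) with hw₁
  set w₂ := NormedSpace.exp (-H₂) *ᵥ b with hw₂
  rw [F_eq, phase_sum, Matrix.fromBlocks_transpose, Matrix.transpose_zero, Matrix.transpose_zero,
    Matrix.exp_fromBlocks_diagonal, Matrix.fromBlocks_neg, neg_zero, neg_zero,
    Matrix.exp_fromBlocks_diagonal, Matrix.add_mulVec, ← Matrix.mulVec_mulVec,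
    ← Matrix.mulVec_mulVec] at hv
  simp only [Matrix.fromBlocks_mulVec, Sum.elim_comp_inl, Sum.elim_comp_inr, Matrix.zero_mulVec,
    zero_add, add_zero] at hv
  have hv1 : NormedSpace.exp H₁ᵀ *ᵥ v₁ + (Q₁ *ᵥ w₁ + Q *ᵥ w₂) = s • T.C :=
    funext fun i => congrFun hv (Sum.inl i)
  have hv2 : NormedSpace.exp H₂ᵀ *ᵥ v₂ + (Qᵀ *ᵥ w₁ + Q₄ *ᵥ w₂) = s • S.C :=
    funext fun i => congrFun hv (Sum.inr i)
  -- P times the second row of the system is the new second row; the old first row minus Q times it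
  -- is the new first row.
  have hP : P *ᵥ (Qᵀ *ᵥ w₁) + P *ᵥ (NormedSpace.exp H₂ᵀ *ᵥ v₂) = s • (P *ᵥ S.C) - w₂ := by
    rw [← Matrix.mulVec_smul, ← hv2, Matrix.mulVec_add, Matrix.mulVec_add, Matrix.mulVec_mulVec w₂,
      hPQ, Matrix.one_mulVec]
    abel
  refine ⟨Sum.elim v₁ b, ?_, ?_, ?_⟩
  · rw [F_eq, phase_flip, Matrix.fromBlocks_transpose, Matrix.transpose_zero, Matrix.transpose_zero,
      Matrix.exp_fromBlocks_diagonal, Matrix.fromBlocks_neg, neg_zero, neg_zero,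
      Matrix.exp_fromBlocks_diagonal, Matrix.add_mulVec, ← Matrix.mulVec_mulVec,
      ← Matrix.mulVec_mulVec, hNv, neg_neg, Matrix.transpose_neg, Matrix.transpose_transpose]
    simp only [flipGram, Matrix.fromBlocks_mulVec, Sum.elim_comp_inl, Sum.elim_comp_inr,
      Matrix.zero_mulVec, zero_add, add_zero]
    rw [← hw₁, ← hw₂]
    ext (i | i)
    · have h1 := congrFun hv1 i
      have h2 := congrFun (congrArg (Q *ᵥ ·) hP) i
      simp only [Matrix.mulVec_add, Matrix.mulVec_sub, Matrix.mulVec_smul, Matrix.sub_mulVec,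
        Matrix.mulVec_neg, ← Matrix.mulVec_mulVec, Pi.add_apply, Pi.sub_apply, Pi.smul_apply,
        Pi.neg_apply, smul_eq_mul, Sum.elim_inl, flip] at h1 h2 ⊢
      linear_combination h1 - h2
    · have h2 := congrFun hP i
      simp only [Matrix.mulVec_neg, Matrix.neg_mulVec, ← Matrix.mulVec_mulVec, Pi.add_apply,
        Pi.sub_apply, Pi.smul_apply, Pi.neg_apply, smul_eq_mul, Sum.elim_inr, flip] at h2 ⊢
      linear_combination h2
  · have h1 : (R *ᵥ S.B) ⬝ᵥ b = S.B ⬝ᵥ (R *ᵥ (Nᵀ *ᵥ v₁)) + S.B ⬝ᵥ v₂ := by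
      rw [← dotProduct_add, ← hRb, Matrix.dotProduct_mulVec, ← Matrix.mulVec_transpose, hR]
    have h2 : (N *ᵥ (R *ᵥ S.B)) ⬝ᵥ v₁ = S.B ⬝ᵥ (R *ᵥ (Nᵀ *ᵥ v₁)) := by
      rw [Matrix.dotProduct_mulVec, Matrix.dotProduct_mulVec, ← Matrix.mulVec_transpose,
        ← Matrix.mulVec_transpose, hR, Matrix.transpose_transpose]
    simp only [flip, sum, sumElim_dotProduct_sumElim, sub_dotProduct, h1, h2]
    ring
  · intro h
    have h1 : v₁ = 0 := funext fun i => congrFun h (Sum.inl i)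
    have h2 : b = 0 := funext fun i => congrFun h (Sum.inr i)
    rw [h1, h2] at hRb
    simp only [Matrix.mulVec_zero, zero_add] at hRb
    rw [h1, ← hRb]
    ext (i | i) <;> rfl

/-- Reflecting part of the spectrum does not change the potential. -/
lemma leadsTo_of_flip {T : RealTriplet ι} {S : RealTriplet κ} {Q₁ N₁ : Matrix ι ι ℝ}
    {Q N : Matrix ι κ ℝ} {Q₄ N₄ P R : Matrix κ κ ℝ} (hPQ : P * Q₄ = 1) (hR : Rᵀ = R)
    (hRN : R * N₄ = 1) (hspec : (T.sum S).SpectrumSplit)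
    (hQ : (T.sum S).SolvesQ (Matrix.fromBlocks Q₁ Q Qᵀ Q₄))
    (hN : (T.sum S).SolvesN (Matrix.fromBlocks N₁ N Nᵀ N₄)) {u : ℝ → ℝ → ℝ}
    (hu : ∀ x t, IsUnit ((T.flip S Q N P R).F (flipGram Q₁ Q P) (flipGram N₁ N R) x t) ∧
      u x t = (T.flip S Q N P R).potential (flipGram Q₁ Q P) (flipGram N₁ N R) x t) :
    (T.sum S).LeadsTo u := by
  refine hspec.leadsTo hQ hN fun x t => ?_
  obtain ⟨hU, hu⟩ := hu x t
  have hU' := (Matrix.isUnit_iff_isUnit_det _).1 hU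
  have hunit : IsUnit ((T.sum S).F (Matrix.fromBlocks Q₁ Q Qᵀ Q₄)
      (Matrix.fromBlocks N₁ N Nᵀ N₄) x t) := by
    refine isUnit_of_mulVec_eq_zero fun v hv => ?_
    obtain ⟨v', h1, -, h3⟩ := F_mulVec_flip (s := 0) hPQ hR hRN (by rw [hv, zero_smul])
    apply h3
    rw [zero_smul] at h1
    have := congrArg (((T.flip S Q N P R).F (flipGram Q₁ Q P) (flipGram N₁ N R) x t)⁻¹ *ᵥ ·) h1
    simpa only [Matrix.mulVec_mulVec, Matrix.nonsing_inv_mul _ hU', Matrix.one_mulVec,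
      Matrix.mulVec_zero] using this
  refine ⟨hunit, ?_⟩
  obtain ⟨v', h1, h2, -⟩ := F_mulVec_flip (T := T) (S := S) (Q₁ := Q₁) (N₁ := N₁) (Q := Q) (N := N)
    (x := x) (t := t) (s := 1) hPQ hR hRN
    (v := ((T.sum S).F (Matrix.fromBlocks Q₁ Q Qᵀ Q₄)
      (Matrix.fromBlocks N₁ N Nᵀ N₄) x t)⁻¹ *ᵥ (T.sum S).C)
    (by rw [Matrix.mulVec_mulVec, Matrix.mul_nonsing_inv _ ((Matrix.isUnit_iff_isUnit_det _).1 hunit),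
      Matrix.one_mulVec, one_smul])
  rw [one_smul] at h1
  rw [hu, potential, potential, ← h2, ← h1, Matrix.mulVec_mulVec, Matrix.nonsing_inv_mul _ hU',
    Matrix.one_mulVec]

lemma flipGram_pos {Q₁ : Matrix ι ι ℝ} {Q : Matrix ι κ ℝ} {P : Matrix κ κ ℝ}
    (h₁ : ∀ v ≠ 0, 0 < v ⬝ᵥ (Q₁ *ᵥ v)) (hP : ∀ v ≠ 0, v ⬝ᵥ (P *ᵥ v) < 0) :
    ∀ v ≠ 0, 0 < v ⬝ᵥ (flipGram Q₁ Q P *ᵥ v) := by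
  intro v hv
  obtain ⟨a, b, rfl⟩ : ∃ a b, v = Sum.elim a b := ⟨_, _, (Sum.elim_comp_inl_inr v).symm⟩
  -- Completing the square in b separates the positive form Q₁ from the negative form P.
  have key : Sum.elim a b ⬝ᵥ (flipGram Q₁ Q P *ᵥ Sum.elim a b) =
      a ⬝ᵥ (Q₁ *ᵥ a) - (b - Qᵀ *ᵥ a) ⬝ᵥ (P *ᵥ (b - Qᵀ *ᵥ a)) := by
    have h : ∀ w, (Qᵀ *ᵥ a) ⬝ᵥ w = a ⬝ᵥ (Q *ᵥ w) := fun w => by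
      rw [Matrix.mulVec_transpose, Matrix.dotProduct_mulVec]
    simp only [flipGram, Matrix.fromBlocks_mulVec, Sum.elim_comp_inl, Sum.elim_comp_inr,
      sumElim_dotProduct_sumElim, sub_dotProduct, dotProduct_sub, dotProduct_add, Matrix.mulVec_sub,
      Matrix.sub_mulVec, Matrix.neg_mulVec, dotProduct_neg, h, ← Matrix.mulVec_mulVec]
    ring
  rw [key]
  rcases eq_or_ne a 0 with rfl | ha
  · have hb : b ≠ 0 := by
      rintro rfl
      exact hv (by ext (i | i) <;> rfl)
    have := hP b hb
    simpa using this
  · have h1 := h₁ a ha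
    rcases eq_or_ne (b - Qᵀ *ᵥ a) 0 with h0 | h0
    · rw [h0]
      simpa using h1
    · have := hP _ h0
      linarith

end RealTriplet

/-! ### Moving the spectrum to the right half-plane. -/

namespace RealTriplet

variable {ι κ : Type} [Fintype ι] [DecidableEq ι] [Fintype κ] [DecidableEq κ]

lemma sum_A_pow_mulVec (T : RealTriplet ι) (S : RealTriplet κ) (k : ℕ) (v : ι → ℝ) (w : κ → ℝ) :
    ((T.sum S).A ^ k) *ᵥ Sum.elim v w = Sum.elim ((T.A ^ k) *ᵥ v) ((S.A ^ k) *ᵥ w) := by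
  rw [sum, Matrix.fromBlocks_diagonal_pow, Matrix.fromBlocks_mulVec]
  simp

lemma IsObservable.of_sum_left {T : RealTriplet ι} {S : RealTriplet κ}
    (h : (T.sum S).IsObservable) : T.IsObservable := by
  intro v hv
  have := h (Sum.elim v 0) fun k => by
    rw [sum_A_pow_mulVec]
    simpa [sum, sumElim_dotProduct_sumElim] using hv k
  exact funext fun i => congrFun this (Sum.inl i)

lemma IsObservable.of_sum_right {T : RealTriplet ι} {S : RealTriplet κ}
    (h : (T.sum S).IsObservable) : S.IsObservable := by
  intro v hv
  have := h (Sum.elim 0 v) fun k => by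
    rw [sum_A_pow_mulVec]
    simpa [sum, sumElim_dotProduct_sumElim] using hv k
  exact funext fun i => congrFun this (Sum.inr i)

/-- The triplet with `A` replaced by `-A`. -/
def neg (T : RealTriplet ι) : RealTriplet ι := ⟨-T.A, T.B, T.C⟩

lemma IsObservable.neg {T : RealTriplet ι} (h : T.IsObservable) : T.neg.IsObservable := by
  intro v hv
  refine h v fun k => ?_
  have := hv k
  simp only [RealTriplet.neg] at this
  rw [neg_pow, ← Matrix.mulVec_mulVec] at this
  rcases neg_one_pow_eq_or (Matrix ι ι ℝ) k with h1 | h1 <;> simpa [h1, Matrix.neg_mulVec] using this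

lemma IsEigenvalue.of_neg {T : RealTriplet ι} {z : ℂ} (hz : T.neg.IsEigenvalue z) :
    T.IsEigenvalue (-z) := by
  rw [isEigenvalue_iff_aeval_charpoly]
  have := hz.aeval_eq_zero (f := T.A.charpoly.comp (-X))
    (by rw [RealTriplet.neg, Matrix.aeval_neg_comp_neg_X, Matrix.aeval_self_charpoly])
  simpa [aeval_comp] using this

/-- With spectrum in the left half-plane, the Lyapunov solution is negative definite. -/
lemma IsObservable.solvesQ_neg {T : RealTriplet ι} (hT : T.IsObservable)
    (h : ∀ z, T.IsEigenvalue z → z.re < 0) {Q : Matrix ι ι ℝ} (hQ : T.SolvesQ Q)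
    {v : ι → ℝ} (hv : v ≠ 0) : v ⬝ᵥ (Q *ᵥ v) < 0 := by
  have hQ' : T.neg.SolvesQ (-Q) := by
    simp only [SolvesQ, RealTriplet.neg, Matrix.transpose_neg, neg_mul_neg]
    exact hQ
  have := hT.neg.solvesQ_pos (fun z hz => by simpa using h _ hz.of_neg) hQ' hv
  simpa [Matrix.neg_mulVec] using this

lemma inv_of_negDef {Q : Matrix ι ι ℝ} (hs : Qᵀ = Q) (h : ∀ v ≠ 0, v ⬝ᵥ (Q *ᵥ v) < 0) :
    Q * Q⁻¹ = 1 ∧ Q⁻¹ * Q = 1 ∧ Q⁻¹ᵀ = Q⁻¹ ∧ ∀ v ≠ 0, v ⬝ᵥ (Q⁻¹ *ᵥ v) < 0 := by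
  have hU : IsUnit Q := isUnit_of_mulVec_eq_zero fun v hv => by
    by_contra h0
    have := h v h0
    rw [hv, dotProduct_zero] at this
    exact lt_irrefl _ this
  have hU' := (Matrix.isUnit_iff_isUnit_det _).1 hU
  have h1 := Matrix.mul_nonsing_inv _ hU'
  refine ⟨h1, Matrix.nonsing_inv_mul _ hU', by rw [Matrix.transpose_nonsing_inv, hs], ?_⟩
  intro v hv
  have hw : Q *ᵥ (Q⁻¹ *ᵥ v) = v := by rw [Matrix.mulVec_mulVec, h1, Matrix.one_mulVec]
  have hw0 : Q⁻¹ *ᵥ v ≠ 0 := fun h0 => hv (by rw [← hw, h0, Matrix.mulVec_zero])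
  have := h _ hw0
  rwa [hw, dotProduct_comm] at this

lemma exists_fromBlocks_of_transpose_eq {Q : Matrix (ι ⊕ κ) (ι ⊕ κ) ℝ} (h : Qᵀ = Q) :
    ∃ Q₁ Q₂ Q₄, Q = Matrix.fromBlocks Q₁ Q₂ Q₂ᵀ Q₄ ∧ Q₄ᵀ = Q₄ := by
  obtain ⟨a, b, c, d, rfl⟩ : ∃ a b c d, Q = Matrix.fromBlocks a b c d :=
    ⟨_, _, _, _, (Matrix.fromBlocks_toBlocks _).symm⟩
  rw [Matrix.fromBlocks_transpose, Matrix.fromBlocks_inj] at h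
  exact ⟨a, b, d, by rw [h.2.2.1], h.2.2.2⟩

lemma IsEigenvalue.of_flip {T : RealTriplet ι} {S : RealTriplet κ} {Q N : Matrix ι κ ℝ}
    {P R : Matrix κ κ ℝ} {z : ℂ} (hz : (T.flip S Q N P R).IsEigenvalue z) :
    T.IsEigenvalue z ∨ S.IsEigenvalue (-z) := by
  rw [isEigenvalue_iff_aeval_charpoly, flip, Matrix.charpoly_fromBlocks_zero₁₂, map_mul,
    mul_eq_zero] at hz
  refine hz.imp (isEigenvalue_iff_aeval_charpoly _ _).2 fun h => IsEigenvalue.of_neg ?_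
  rw [← isEigenvalue_dual, isEigenvalue_iff_aeval_charpoly]
  simpa [dual, neg] using h

/-- The part of the spectrum in the left half-plane can be reflected to the right half-plane. -/
lemma exists_equivalent_pos {T : RealTriplet ι} {S : RealTriplet κ} (h : (T.sum S).IsAdmissible)
    (hT : ∀ z, T.IsEigenvalue z → 0 < z.re) (hS : ∀ z, S.IsEigenvalue z → z.re < 0) :
    ∃ T' : RealTriplet (ι ⊕ κ), T'.IsMinimal ∧ (∀ z, T'.IsEigenvalue z → 0 < z.re) ∧
      (T.sum S).Equivalent T' := by
  have hsp := h.spectrumSplit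
  have hmin := h.minimal
  have hobs : (T.sum S).IsObservable := hmin.1
  have hctr : (T.dual.sum S.dual).IsObservable := by
    rw [← dual_sum]
    exact hmin.2
  obtain ⟨Q, hQ⟩ := hsp.exists_solvesQ
  obtain ⟨N, hN⟩ := hsp.dual.exists_solvesQ
  obtain ⟨Q₁, Q₂, Q₄, rfl, hQ₄⟩ := exists_fromBlocks_of_transpose_eq (hsp.solvesQ_transpose hQ)
  obtain ⟨N₁, N₂, N₄, rfl, hN₄⟩ := exists_fromBlocks_of_transpose_eq (hsp.dual.solvesQ_transpose hN)
  have hN' := hN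
  rw [dual_sum] at hN'
  obtain ⟨hQ11, -, -, hQ44⟩ := (solvesQ_sum_iff T S).1 hQ
  obtain ⟨hN11, -, -, hN44⟩ := (solvesQ_sum_iff T.dual S.dual).1 hN'
  -- The summand S inherits observability and has spectrum in the left half-plane, so Q₄ is negative
  -- definite, in particular invertible. The same holds for N₄ by duality.
  obtain ⟨hQP, hPQ, hP, hPneg⟩ := inv_of_negDef hQ₄
    fun v hv => hobs.of_sum_right.solvesQ_neg hS hQ44 hv
  obtain ⟨hNR, hRN, hR, hRneg⟩ := inv_of_negDef hN₄
    fun v hv => hctr.of_sum_right.solvesQ_neg (fun z hz => hS z ((isEigenvalue_dual S z).1 hz)) hN44 hv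
  have hQpos := flipGram_pos (Q := Q₂)
    (fun v hv => hobs.of_sum_left.solvesQ_pos hT hQ11 (v := v) hv) hPneg
  have hNpos := flipGram_pos (Q := N₂)
    (fun v hv => hctr.of_sum_left.solvesQ_pos (fun z hz => hT z ((isEigenvalue_dual T z).1 hz)) hN11
      (v := v) hv) hRneg
  have hspec : ∀ z, (T.flip S Q₂ N₂ Q₄⁻¹ N₄⁻¹).IsEigenvalue z → 0 < z.re := fun z hz =>
    hz.of_flip.elim (hT z) fun h => by simpa using hS _ h
  have hsp' := spectrumSplit_of_pos hspec
  have hQ' := solvesQ_flip hQ hP hQP hPQ N₂ N₄⁻¹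
  have hN'' : (T.flip S Q₂ N₂ Q₄⁻¹ N₄⁻¹).dual.SolvesQ (flipGram N₁ N₂ N₄⁻¹) := by
    rw [dual_flip]
    exact solvesQ_flip hN' hR hNR hRN _ _
  have hinj : ∀ {M : Matrix (ι ⊕ κ) (ι ⊕ κ) ℝ}, (∀ v ≠ 0, 0 < v ⬝ᵥ (M *ᵥ v)) →
      ∀ v, M *ᵥ v = 0 → v = 0 := fun {M} hM v hv => by
    by_contra h0
    have := hM v h0
    rw [hv, dotProduct_zero] at this
    exact lt_irrefl _ this
  -- Minimality of the reflected triplet is read off from the injectivity of its two definite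
  -- Lyapunov solutions.
  refine ⟨T.flip S Q₂ N₂ Q₄⁻¹ N₄⁻¹,
    ⟨hsp'.isObservable hQ' (hinj hQpos), hsp'.dual.isObservable hN'' (hinj hNpos)⟩, hspec,
    (T.flip S Q₂ N₂ Q₄⁻¹ N₄⁻¹).potential (flipGram Q₁ Q₂ Q₄⁻¹) (flipGram N₁ N₂ N₄⁻¹), ?_, ?_⟩
  · exact leadsTo_of_flip hPQ hR hRN hsp hQ ((solvesN_iff_dual _ _).2 hN) fun x t =>
      ⟨isUnit_F_of_pos _ hQpos hNpos x t, rfl⟩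
  · exact hsp'.leadsTo hQ' ((solvesN_iff_dual _ _).2 hN'') fun x t =>
      ⟨isUnit_F_of_pos _ hQpos hNpos x t, rfl⟩

/-! ### Controllable pairs as cyclic modules. -/

/-- Evaluation of polynomials at `A`, applied to `B`. -/
noncomputable def krylov (T : RealTriplet ι) : ℝ[X] →ₗ[ℝ] (ι → ℝ) where
  toFun f := aeval T.A f *ᵥ T.B
  map_add' f g := by rw [map_add, Matrix.add_mulVec]
  map_smul' c f := by rw [map_smul, Matrix.smul_mulVec, RingHom.id_apply]

lemma krylov_apply (T : RealTriplet ι) (f : ℝ[X]) : T.krylov f = aeval T.A f *ᵥ T.B := rfl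

lemma krylov_mul (T : RealTriplet ι) (f g : ℝ[X]) : T.krylov (f * g) = aeval T.A f *ᵥ T.krylov g := by
  rw [krylov_apply, krylov_apply, map_mul, Matrix.mulVec_mulVec]

lemma dotProduct_krylov_eq_zero {T : RealTriplet ι} {v : ι → ℝ}
    (hv : ∀ k : ℕ, T.dual.C ⬝ᵥ ((T.dual.A ^ k) *ᵥ v) = 0) (f : ℝ[X]) : v ⬝ᵥ T.krylov f = 0 := by
  rw [krylov_apply, aeval_eq_sum_range, Matrix.sum_mulVec, dotProduct_sum]
  refine Finset.sum_eq_zero fun k _ => ?_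
  rw [Matrix.smul_mulVec, dotProduct_smul, Matrix.dotProduct_mulVec, ← Matrix.mulVec_transpose,
    Matrix.transpose_pow, dotProduct_comm]
  simp only [dual] at hv
  rw [hv, smul_zero]

/-- Observability of the dual is controllability: only 0 is orthogonal to all vectors f(A)B. -/
lemma dual_isObservable_iff (T : RealTriplet ι) :
    T.dual.IsObservable ↔ ∀ v : ι → ℝ, (∀ f, v ⬝ᵥ T.krylov f = 0) → v = 0 := by
  refine ⟨fun h v hv => h v fun k => ?_, fun h v hv => h v (dotProduct_krylov_eq_zero hv)⟩
  have := hv (X ^ k)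
  rw [krylov_apply, map_pow, aeval_X, Matrix.dotProduct_mulVec, ← Matrix.mulVec_transpose,
    Matrix.transpose_pow, dotProduct_comm] at this
  exact this

lemma krylov_surjective {T : RealTriplet ι} (h : T.dual.IsObservable) :
    Function.Surjective T.krylov := by
  rw [← LinearMap.range_eq_top]
  by_contra hne
  obtain ⟨f, hf0, hf⟩ := Submodule.exists_le_ker_of_lt_top _ (lt_top_iff_ne_top.2 hne)
  apply hf0
  have hfv : ∀ w, f w = (fun i => f (Pi.single i 1)) ⬝ᵥ w := fun w => by
    conv_lhs => rw [pi_eq_sum_univ' w]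
    simp [dotProduct, mul_comm]
  have := (dual_isObservable_iff T).1 h (fun i => f (Pi.single i 1)) fun g => by
    rw [← hfv]
    exact hf ⟨g, rfl⟩
  ext w
  simpa using congrFun this w

/-- Reduction modulo χ keeps the map surjective on polynomials of degree below the dimension. That
space has the same dimension as the target, so the map is injective on remainders. -/
lemma krylov_eq_zero_iff {T : RealTriplet ι} (h : T.dual.IsObservable) {χ : ℝ[X]} (hχ : χ.Monic)
    (hdeg : χ.natDegree = Fintype.card ι) (hA : aeval T.A χ = 0) (f : ℝ[X]) :
    T.krylov f = 0 ↔ χ ∣ f := by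
  have hzero : ∀ g, T.krylov (χ * g) = 0 := fun g => by
    rw [krylov_mul, hA, Matrix.zero_mulVec]
  refine ⟨fun hf => ?_, fun ⟨g, hg⟩ => hg ▸ hzero g⟩
  have hmod : ∀ g, T.krylov (g %ₘ χ) = T.krylov g := fun g => by
    conv_rhs => rw [← modByMonic_add_div g χ, map_add, hzero, add_zero]
  have hmem : ∀ g : ℝ[X], g %ₘ χ ∈ degreeLT ℝ (Fintype.card ι) := fun g => by
    rw [mem_degreeLT, ← hdeg, ← degree_eq_natDegree hχ.ne_zero]
    exact degree_modByMonic_lt _ hχ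
  let ψ : degreeLT ℝ (Fintype.card ι) →ₗ[ℝ] (ι → ℝ) := T.krylov.domRestrict _
  have hsurj : Function.Surjective ψ := fun v => by
    obtain ⟨g, rfl⟩ := krylov_surjective h v
    exact ⟨⟨g %ₘ χ, hmem g⟩, hmod g⟩
  have : FiniteDimensional ℝ (degreeLT ℝ (Fintype.card ι)) :=
    Module.Finite.equiv (degreeLTEquiv ℝ (Fintype.card ι)).symm
  have hfin : Module.finrank ℝ (degreeLT ℝ (Fintype.card ι)) = Module.finrank ℝ (ι → ℝ) := by
    rw [(degreeLTEquiv ℝ (Fintype.card ι)).finrank_eq]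
    simp
  have hinj := (LinearMap.injective_iff_surjective_of_finrank_eq_finrank hfin).2 hsurj
  rw [← modByMonic_eq_zero_iff_dvd hχ]
  have := @hinj ⟨f %ₘ χ, hmem f⟩ 0 (by rw [map_zero]; exact (hmod f).trans hf)
  exact congrArg Subtype.val this

/-- Two controllable pairs with the same characteristic polynomial are similar. -/
lemma exists_isSimilar {T : RealTriplet ι} {T' : RealTriplet κ} (h : T.dual.IsObservable)
    (h' : T'.dual.IsObservable) {χ : ℝ[X]} (hχ : χ.Monic) (hdeg : χ.natDegree = Fintype.card ι)
    (hdeg' : χ.natDegree = Fintype.card κ) (hA : aeval T.A χ = 0) (hA' : aeval T'.A χ = 0) :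
    ∃ C S S', IsSimilar T ⟨T'.A, T'.B, C⟩ S S' := by
  have hker : LinearMap.ker T.krylov = LinearMap.ker T'.krylov := by
    ext f
    rw [LinearMap.mem_ker, LinearMap.mem_ker, krylov_eq_zero_iff h hχ hdeg hA,
      krylov_eq_zero_iff h' hχ hdeg' hA']
  -- Both state spaces are the quotient of ℝ[X] by the same kernel; L sends f(A)B to f(A')B'.
  let L : (ι → ℝ) ≃ₗ[ℝ] (κ → ℝ) :=
    (T.krylov.quotKerEquivOfSurjective (krylov_surjective h)).symm ≪≫ₗ
      Submodule.quotEquivOfEq _ _ hker ≪≫ₗ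
      T'.krylov.quotKerEquivOfSurjective (krylov_surjective h')
  have hL : ∀ f, L (T.krylov f) = T'.krylov f := fun f => by
    have h1 : (T.krylov.quotKerEquivOfSurjective (krylov_surjective h)).symm (T.krylov f) =
        Submodule.Quotient.mk f := by
      rw [LinearEquiv.symm_apply_eq]
      rfl
    simp only [L, LinearEquiv.trans_apply, h1]
    rfl
  refine ⟨fun j => T.C ⬝ᵥ L.symm (Pi.single j 1), _, _, IsSimilar.of_linearEquiv L ?_ ?_ ?_⟩
  · intro v
    obtain ⟨f, rfl⟩ := krylov_surjective h v
    have h1 := krylov_mul T X f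
    have h2 := krylov_mul T' X f
    rw [aeval_X] at h1 h2
    rw [← h1, hL, h2, hL]
  · simpa [krylov_apply] using hL 1
  · intro v
    have : ∀ w, (fun j => T.C ⬝ᵥ L.symm (Pi.single j 1)) ⬝ᵥ w = T.C ⬝ᵥ L.symm w := fun w => by
      conv_rhs => rw [pi_eq_sum_univ' w]
      simp only [map_sum, map_smul, dotProduct_sum, dotProduct_smul]
      simp [dotProduct, mul_comm]
    rw [this, LinearEquiv.symm_apply_apply]

/-- Every monic polynomial is the characteristic polynomial of a controllable pair. -/
lemma exists_controllable {χ : ℝ[X]} (hχ : χ.Monic) :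
    ∃ T : RealTriplet (Fin χ.natDegree), T.dual.IsObservable ∧ aeval T.A χ = 0 := by
  let pb := AdjoinRoot.powerBasis' hχ
  let e := pb.basis.reindex (finCongr (AdjoinRoot.powerBasis'_dim hχ))
  -- Multiplication by the root on ℝ[X]/(χ), with cyclic vector 1. The row plays no role and is set
  -- to 0.
  let T : RealTriplet (Fin χ.natDegree) :=
    ⟨Algebra.leftMulMatrix e (AdjoinRoot.root χ), e.equivFun 1, 0⟩
  have haev : ∀ f, aeval T.A f = Algebra.leftMulMatrix e (AdjoinRoot.mk χ f) := fun f => by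
    rw [← AdjoinRoot.aeval_eq, Polynomial.aeval_algHom_apply]
  have hk : ∀ f, T.krylov f = e.equivFun (AdjoinRoot.mk χ f) := fun f => by
    rw [krylov_apply, haev]
    change _ *ᵥ (e.repr 1) = _
    rw [Algebra.leftMulMatrix_mulVec_repr, mul_one]
    rfl
  refine ⟨T, ?_, ?_⟩
  · rw [dual_isObservable_iff]
    intro v hv
    -- The polynomial f is chosen with f(A)B = v, so the hypothesis becomes v · v = 0.
    obtain ⟨f, hf⟩ := AdjoinRoot.mk_surjective (e.equivFun.symm v)
    have := hv f
    rw [hk, hf, LinearEquiv.apply_symm_apply] at this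
    exact dotProduct_self_eq_zero.1 this
  · rw [haev, AdjoinRoot.mk_self, map_zero]

end RealTriplet

/-! ### Real factorization over roots in the closed upper half-plane. -/

section Factorization

/-- The monic real polynomial of least degree vanishing at `z`. -/
noncomputable def rootFactor (z : ℂ) : ℝ[X] :=
  if z.im = 0 then X - C z.re else X ^ 2 - C (2 * z.re) * X + C (‖z‖ ^ 2)

lemma rootFactor_monic (z : ℂ) : (rootFactor z).Monic := by
  unfold rootFactor
  split_ifs
  · exact monic_X_sub_C _
  · monicity!

lemma natDegree_rootFactor (z : ℂ) : (rootFactor z).natDegree = if z.im = 0 then 1 else 2 := by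
  unfold rootFactor
  split_ifs
  · exact natDegree_X_sub_C _
  · compute_degree!

lemma aeval_rootFactor_eq_zero_iff (z w : ℂ) :
    aeval w (rootFactor z) = 0 ↔ w = z ∨ w = (starRingEnd ℂ) z := by
  unfold rootFactor
  split_ifs with h
  · have hz : (z.re : ℂ) = z := Complex.ext (by simp) (by simp [h])
    rw [Complex.conj_eq_iff_im.2 h]
    simp [hz, sub_eq_zero]
  · have : aeval w (X ^ 2 - C (2 * z.re) * X + C (‖z‖ ^ 2)) = (w - z) * (w - (starRingEnd ℂ) z) := by
      have h1 := Complex.add_conj z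
      have h2 := Complex.mul_conj' z
      simp only [map_add, map_sub, map_mul, map_pow, aeval_X, aeval_C, Complex.coe_algebraMap]
      push_cast at h1 ⊢
      linear_combination w * h1 - h2
    rw [this, mul_eq_zero, sub_eq_zero, sub_eq_zero]

lemma rootFactor_dvd {f : ℝ[X]} {z : ℂ} (hz : aeval z f = 0) : rootFactor z ∣ f := by
  unfold rootFactor
  split_ifs with h
  · have hz' : (z.re : ℂ) = z := Complex.ext (by simp) (by simp [h])
    rw [dvd_iff_isRoot, IsRoot]
    rw [← hz', ← Complex.coe_algebraMap, aeval_algebraMap_apply] at hz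
    simpa using hz
  · exact f.quadratic_dvd_of_aeval_eq_zero_im_ne_zero hz h

/-- A monic real polynomial is a product of factors belonging to roots in the closed upper
half-plane. -/
lemma exists_eq_prod_rootFactor (n : ℕ) : ∀ f : ℝ[X], f.Monic → f.natDegree = n →
    ∃ M : Multiset ℂ, (∀ z ∈ M, 0 ≤ z.im ∧ aeval z f = 0) ∧ f = (M.map rootFactor).prod := by
  induction n using Nat.strong_induction_on with
  | _ n ih =>
    intro f hf hn
    rcases eq_or_ne f 1 with rfl | hf1
    · exact ⟨0, by simp, by simp⟩
    have hdeg : f.degree ≠ 0 := fun h => hf1 (hf.natDegree_eq_zero.1 (natDegree_eq_of_degree_eq_some h))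
    obtain ⟨z, hz, hzim⟩ : ∃ z : ℂ, aeval z f = 0 ∧ 0 ≤ z.im := by
      obtain ⟨z, hz⟩ := IsAlgClosed.exists_aeval_eq_zero ℂ f hdeg
      rcases le_total 0 z.im with h | h
      · exact ⟨z, hz, h⟩
      · exact ⟨(starRingEnd ℂ) z, by rw [aeval_conj, hz, map_zero], by simpa using h⟩
    obtain ⟨g, hg⟩ := rootFactor_dvd hz
    have hgm : g.Monic := (rootFactor_monic z).of_mul_monic_left (hg ▸ hf)
    have hlt : g.natDegree < n := by
      rw [← hn, hg, (rootFactor_monic z).natDegree_mul hgm, natDegree_rootFactor]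
      split_ifs <;> omega
    obtain ⟨M, hM, hgM⟩ := ih _ hlt g hgm rfl
    refine ⟨z ::ₘ M, ?_, by rw [Multiset.map_cons, Multiset.prod_cons, ← hgM, ← hg]⟩
    intro w hw
    rcases Multiset.mem_cons.1 hw with rfl | hw
    · exact ⟨hzim, hz⟩
    · exact ⟨(hM w hw).1, by rw [hg, map_mul, (hM w hw).2, mul_zero]⟩

lemma monic_prod_rootFactor (M : Multiset ℂ) : (M.map rootFactor).prod.Monic :=
  monic_multiset_prod_of_monic _ _ fun z _ => rootFactor_monic z

lemma aeval_prod_rootFactor {M : Multiset ℂ} {z : ℂ} (h : aeval z (M.map rootFactor).prod = 0) :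
    ∃ w ∈ M, z = w ∨ z = (starRingEnd ℂ) w := by
  rw [map_multiset_prod, Multiset.prod_eq_zero_iff, Multiset.map_map] at h
  obtain ⟨w, hw, h0⟩ := Multiset.mem_map.1 h
  exact ⟨w, hw, (aeval_rootFactor_eq_zero_iff w z).1 h0⟩

end Factorization

/-! ### Splitting the spectrum by half-planes. -/

namespace RealTriplet

variable {ι κ : Type} [Fintype ι] [DecidableEq ι] [Fintype κ] [DecidableEq κ]

lemma aeval_sum_A (T : RealTriplet ι) (S : RealTriplet κ) (f : ℝ[X]) :
    aeval (T.sum S).A f = Matrix.fromBlocks (aeval T.A f) 0 0 (aeval S.A f) := by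
  induction f using Polynomial.induction_on' with
  | add p q hp hq => simp [hp, hq, Matrix.fromBlocks_add]
  | monomial n a =>
    simp [aeval_monomial, Algebra.algebraMap_eq_smul_one, sum, Matrix.fromBlocks_diagonal_pow,
      Matrix.fromBlocks_smul]

lemma krylov_sum (T : RealTriplet ι) (S : RealTriplet κ) (f : ℝ[X]) :
    (T.sum S).krylov f = Sum.elim (T.krylov f) (S.krylov f) := by
  rw [krylov_apply, aeval_sum_A, Matrix.fromBlocks_mulVec]
  simp [sum, krylov_apply]

/-- By Bézout h = f r h + g s h. The first term acts trivially on T and the second on S, so the two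
components of a test vector can be probed independently. -/
lemma dual_isObservable_sum {T : RealTriplet ι} {S : RealTriplet κ} (hT : T.dual.IsObservable)
    (hS : S.dual.IsObservable) {f g : ℝ[X]} (hf : aeval T.A f = 0) (hg : aeval S.A g = 0)
    (hfg : IsCoprime f g) : (T.sum S).dual.IsObservable := by
  rw [dual_isObservable_iff] at *
  intro v hv
  obtain ⟨a, b, rfl⟩ : ∃ a b, v = Sum.elim a b := ⟨_, _, (Sum.elim_comp_inl_inr v).symm⟩
  simp only [krylov_sum, sumElim_dotProduct_sumElim] at hv
  obtain ⟨r, s, hrs⟩ := hfg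
  have hf' : ∀ h, T.krylov (f * h) = 0 := fun h => by rw [krylov_mul, hf, Matrix.zero_mulVec]
  have hg' : ∀ h, S.krylov (g * h) = 0 := fun h => by rw [krylov_mul, hg, Matrix.zero_mulVec]
  have ha : a = 0 := hT a fun h => by
    have := hv (g * (s * h))
    rw [hg', dotProduct_zero, add_zero] at this
    rw [show h = f * (r * h) + g * (s * h) by linear_combination -h * hrs, map_add, hf', zero_add,
      this]
  have hb : b = 0 := hS b fun h => by
    have := hv (f * (r * h))
    rw [hf', dotProduct_zero, zero_add] at this
    rw [show h = f * (r * h) + g * (s * h) by linear_combination -h * hrs, map_add, hg', add_zero,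
      this]
  rw [ha, hb]
  ext (i | i) <;> rfl

/-- An admissible triplet is equivalent to a minimal one with spectrum in the right half-plane. -/
lemma IsAdmissible.exists_equivalent_pos {T : RealTriplet ι} (h : T.IsAdmissible) :
    ∃ (m n : ℕ) (T' : RealTriplet (Fin m ⊕ Fin n)), m + n = Fintype.card ι ∧ T'.IsMinimal ∧
      (∀ z, T'.IsEigenvalue z → 0 < z.re) ∧ T.Equivalent T' := by
  obtain ⟨M, hM, hχ⟩ := exists_eq_prod_rootFactor _ _ T.A.charpoly_monic rfl
  set f := ((M.filter fun z => 0 < z.re).map rootFactor).prod with hf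
  set g := ((M.filter fun z => ¬ 0 < z.re).map rootFactor).prod with hg
  have hfg : T.A.charpoly = f * g := by
    rw [hχ, hf, hg, ← Multiset.prod_add, ← Multiset.map_add, Multiset.filter_add_not]
  have hroot_f : ∀ z : ℂ, aeval z f = 0 → 0 < z.re := fun z hz => by
    obtain ⟨w, hw, hzw⟩ := aeval_prod_rootFactor hz
    have := (Multiset.mem_filter.1 hw).2
    rcases hzw with rfl | rfl <;> simpa using this
  -- The complementary filter only gives real part ≤ 0; it is strict because no eigenvalue lies on
  -- the imaginary axis.
  have hroot_g : ∀ z : ℂ, aeval z g = 0 → z.re < 0 := fun z hz => by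
    obtain ⟨w, hw, hzw⟩ := aeval_prod_rootFactor hz
    have h1 := Multiset.mem_filter.1 hw
    have h2 := h.re_ne_zero w ((isEigenvalue_iff_aeval_charpoly _ _).2 (hM w h1.1).2)
    have h3 := lt_of_le_of_ne (not_lt.1 h1.2) h2
    rcases hzw with rfl | rfl <;> simpa using h3
  have hcop : IsCoprime f g := by
    rw [Polynomial.isCoprime_iff_aeval_ne_zero_of_isAlgClosed ℝ ℂ]
    intro z
    by_contra! hz
    exact lt_asymm (hroot_f z hz.1) (hroot_g z hz.2)
  have hfm : f.Monic := monic_prod_rootFactor _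
  have hgm : g.Monic := monic_prod_rootFactor _
  obtain ⟨T₁, hT₁, hT₁f⟩ := exists_controllable hfm
  obtain ⟨S₁, hS₁, hS₁g⟩ := exists_controllable hgm
  have hcard : f.natDegree + g.natDegree = Fintype.card ι := by
    rw [← hfm.natDegree_mul hgm, ← hfg, Matrix.charpoly_natDegree_eq_dim]
  -- The zero rows of the two models are discarded; C is the row transported from T.
  obtain ⟨C, S, S', hsim⟩ := exists_isSimilar (T := T) (T' := T₁.sum S₁) h.minimal.2
    (dual_isObservable_sum hT₁ hS₁ hT₁f hS₁g hcop) T.A.charpoly_monic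
    (Matrix.charpoly_natDegree_eq_dim _)
    (by rw [Matrix.charpoly_natDegree_eq_dim, ← hcard]; simp) (Matrix.aeval_self_charpoly _)
    (by rw [hfg, aeval_sum_A, map_mul, map_mul, hT₁f, hS₁g]; simp)
  set T₂ : RealTriplet (Fin f.natDegree) := ⟨T₁.A, T₁.B, fun i => C (Sum.inl i)⟩
  set S₂ : RealTriplet (Fin g.natDegree) := ⟨S₁.A, S₁.B, fun i => C (Sum.inr i)⟩
  have hsum : (⟨(T₁.sum S₁).A, (T₁.sum S₁).B, C⟩ : RealTriplet _) = T₂.sum S₂ := by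
    simp only [sum, T₂, S₂, RealTriplet.mk.injEq, true_and]
    ext (i | i) <;> rfl
  rw [hsum] at hsim
  obtain ⟨T', h1, h2, u, hu1, hu2⟩ := RealTriplet.exists_equivalent_pos (hsim.isAdmissible h)
    (fun z hz => hroot_f z (hz.aeval_eq_zero hT₁f)) (fun z hz => hroot_g z (hz.aeval_eq_zero hS₁g))
  exact ⟨_, _, T', hcard, h1, h2, u, hsim.leadsTo h.spectrumSplit hu1, hu2⟩

end RealTriplet

/-! ### Observability tested on the kernel of a nilpotent polynomial. -/

namespace RealTriplet

variable {ι : Type} [Fintype ι] [DecidableEq ι]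

/-- If `p(A)` is nilpotent, observability has to be tested on the kernel of `p(A)` only. -/
lemma isObservable_of_aeval_pow {T : RealTriplet ι} {p : ℝ[X]} {N : ℕ} (hp : aeval T.A p ^ N = 0)
    (h : ∀ v, aeval T.A p *ᵥ v = 0 → (∀ k : ℕ, T.C ⬝ᵥ ((T.A ^ k) *ᵥ v) = 0) → v = 0) :
    T.IsObservable := by
  intro v hv
  have hinv : ∀ (f : ℝ[X]) (k : ℕ), T.C ⬝ᵥ ((T.A ^ k) *ᵥ (aeval T.A f *ᵥ v)) = 0 := by
    intro f k
    have hcomm : T.A ^ k * aeval T.A f = aeval T.A (f * X ^ k) := by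
      rw [mul_comm, map_mul, map_pow, aeval_X]
    rw [Matrix.mulVec_mulVec, hcomm, aeval_eq_sum_range, Matrix.sum_mulVec, dotProduct_sum]
    exact Finset.sum_eq_zero fun k _ => by simp [Matrix.smul_mulVec, hv k]
  -- If p(A)^{m+1} v = 0, then p(A)^m v is an unobservable vector in ker p(A), hence zero; the
  -- exponent descends to 0.
  have key : ∀ m : ℕ, (aeval T.A p ^ m) *ᵥ v = 0 → v = 0 := by
    intro m
    induction m with
    | zero => intro h0; simpa using h0
    | succ m ih =>
      intro h0
      apply ih
      apply h
      · rw [Matrix.mulVec_mulVec, ← pow_succ', h0]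
      · simpa using hinv (p ^ m)
  exact key N (by rw [hp, Matrix.zero_mulVec])

end RealTriplet

/-! ### Controllability and observability of one canonical block. -/

namespace CanonicalBlock

/-- The triplet of a single block. -/
def blockTriplet (b : CanonicalBlock) : RealTriplet b.Idx := ⟨b.matA, b.colB, b.rowC⟩

/-- One less than the order of the Jordan block. -/
def order : CanonicalBlock → ℕ
  | real _ n _ => n
  | pair _ _ n _ _ => n

/-- In blocks of the second kind the imaginary part is positive. -/
def IsStandard : CanonicalBlock → Prop
  | real _ _ _ => True
  | pair _ β _ _ _ => 0 < β

/-- The shift towards higher indices. -/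
def shift {n : ℕ} {α : Type} (v : Fin (n + 1) × α → ℝ) : Fin (n + 1) × α → ℝ := fun i =>
  if h : 0 < (i.1 : ℕ) then v (⟨i.1 - 1, by omega⟩, i.2) else 0

lemma shift_eq_zero {n m : ℕ} {α : Type} {v : Fin (n + 1) × α → ℝ}
    (hv : ∀ i : Fin (n + 1), (i : ℕ) < m → ∀ a, v (i, a) = 0) (i : Fin (n + 1))
    (hi : (i : ℕ) < m + 1) (a : α) : shift v (i, a) = 0 := by
  unfold shift
  split_ifs with h
  · exact hv _ (by simp only at h ⊢; omega) _
  · rfl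

lemma shift_succ {n k : ℕ} {α : Type} (v : Fin (n + 1) × α → ℝ) (hk : k + 1 < n + 1) (a : α) :
    shift v (⟨k + 1, hk⟩, a) = v (⟨k, by omega⟩, a) := by
  simp [shift]

lemma sum_ite_eq_shift {n : ℕ} {α : Type} (v : Fin (n + 1) × α → ℝ) (i : Fin (n + 1)) (a : α) :
    (∑ k : Fin (n + 1), if (i : ℕ) = (k : ℕ) + 1 then v (k, a) else 0) = shift v (i, a) := by
  unfold shift
  split_ifs with h
  · rw [Finset.sum_eq_single (⟨i - 1, by omega⟩ : Fin (n + 1))]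
    · rw [if_pos]
      simp only at h ⊢
      omega
    · intro k _ hk
      rw [if_neg]
      intro hik
      apply hk
      ext
      simp only
      omega
    · simp
  · refine Finset.sum_eq_zero fun k _ => if_neg ?_
    simp only at h
    omega

/-- This is the action of a lower bidiagonal matrix, the common shape of the transposed blocks; α is
`Unit` for real eigenvalues and `Fin 2` for pairs. -/
lemma sum_ite_ite_mul {n : ℕ} {α : Type} (v : Fin (n + 1) × α → ℝ) (i : Fin (n + 1)) (a : α)
    (x y : ℝ) :
    (∑ k : Fin (n + 1), (if i = k then x else if (i : ℕ) = (k : ℕ) + 1 then y else 0) * v (k, a)) =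
      x * v (i, a) + y * shift v (i, a) := by
  have h : ∀ k : Fin (n + 1),
      (if i = k then x else if (i : ℕ) = (k : ℕ) + 1 then y else 0) * v (k, a) =
      (if i = k then x * v (k, a) else 0) +
        y * (if (i : ℕ) = (k : ℕ) + 1 then v (k, a) else 0) := by
    intro k
    by_cases h : i = k
    · subst h; simp
    · simp only [h, if_false]
      split_ifs <;> simp
  rw [Finset.sum_congr rfl fun k _ => h k, Finset.sum_add_distrib, ← Finset.mul_sum,
    sum_ite_eq_shift]
  simp

/-- The triplet of a block belonging to a real eigenvalue. -/
def realTriplet (ω : ℝ) (n : ℕ) (c : Fin (n + 1) → ℝ) : RealTriplet (Fin (n + 1)) where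
  A := Matrix.of fun i k => if k = i then ω else if (k : ℕ) = (i : ℕ) + 1 then -1 else 0
  B := fun i => if i = Fin.last n then 1 else 0
  C := fun i => c i.rev

/-- The triplet of a block belonging to a pair of complex eigenvalues. -/
def pairTriplet (α β : ℝ) (n : ℕ) (γ ε : Fin (n + 1) → ℝ) :
    RealTriplet (Fin (n + 1) × Fin 2) where
  A := Matrix.of fun i k => if k.1 = i.1 then rotBlock α β i.2 k.2
      else if (k.1 : ℕ) = (i.1 : ℕ) + 1 then -(1 : Matrix (Fin 2) (Fin 2) ℝ) i.2 k.2 else 0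
  B := fun i => if i = (Fin.last n, 1) then 1 else 0
  C := fun i => if i.2 = 0 then γ i.1.rev else ε i.1.rev

section Real

variable {ω : ℝ} {n : ℕ} {c : Fin (n + 1) → ℝ}

lemma realTriplet_transpose_mulVec (v : Fin (n + 1) → ℝ) (i : Fin (n + 1)) :
    ((realTriplet ω n c).Aᵀ *ᵥ v) i =
      ω * v i - shift (fun j : Fin (n + 1) × Unit => v j.1) (i, ()) := by
  have := sum_ite_ite_mul (fun j : Fin (n + 1) × Unit => v j.1) i () ω (-1)
  simp only [Matrix.mulVec, dotProduct, Matrix.transpose_apply, realTriplet, Matrix.of_apply]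
  rw [this]
  ring

lemma realTriplet_aeval_mulVec (v : Fin (n + 1) → ℝ) (i : Fin (n + 1)) :
    (aeval (realTriplet ω n c).Aᵀ (rootFactor ⟨ω, 0⟩) *ᵥ v) i =
      - shift (fun j : Fin (n + 1) × Unit => v j.1) (i, ()) := by
  simp [rootFactor, Matrix.sub_mulVec, realTriplet_transpose_mulVec,
    Algebra.algebraMap_eq_smul_one, Matrix.smul_mulVec]

/-- Each factor is minus the shift and makes one more initial entry vanish. -/
lemma realTriplet_aeval_pow : aeval (realTriplet ω n c).Aᵀ (rootFactor ⟨ω, 0⟩) ^ (n + 1) = 0 := by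
  have key : ∀ (m : ℕ) (v : Fin (n + 1) → ℝ) (i : Fin (n + 1)), (i : ℕ) < m →
      ((aeval (realTriplet ω n c).Aᵀ (rootFactor ⟨ω, 0⟩) ^ m) *ᵥ v) i = 0 := by
    intro m v
    induction m with
    | zero => intro i hi; omega
    | succ m ih =>
      intro i hi
      rw [pow_succ', ← Matrix.mulVec_mulVec, realTriplet_aeval_mulVec, neg_eq_zero]
      exact shift_eq_zero (m := m) (fun i hi _ => ih i hi) i hi ()
  refine Matrix.mulVec_injective (funext fun v => funext fun i => ?_)
  rw [key _ _ _ i.2, Matrix.zero_mulVec, Pi.zero_apply]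

/-- The kernel of the shift consists of vectors supported at the last index, which is the entry that
B reads. -/
lemma realTriplet_dual_isObservable : (realTriplet ω n c).dual.IsObservable := by
  refine RealTriplet.isObservable_of_aeval_pow (p := rootFactor ⟨ω, 0⟩) realTriplet_aeval_pow
    fun v hv hobs => ?_
  ext i
  by_cases hi : (i : ℕ) < n
  · have h1 := congrFun hv ⟨i + 1, by omega⟩
    rw [RealTriplet.dual, realTriplet_aeval_mulVec, Pi.zero_apply, neg_eq_zero, shift_succ] at h1
    exact h1
  · have hlast : i = Fin.last n := Fin.ext (by have := i.2; simp only [Fin.val_last]; omega)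
    have h1 := hobs 0
    rw [pow_zero, Matrix.one_mulVec] at h1
    simpa [RealTriplet.dual, realTriplet, dotProduct, hlast] using h1

/-- The first basis vector is an eigenvector of A, and C takes the value c(`Fin.last n`) on it. -/
lemma realTriplet_c_ne_zero (h : (realTriplet ω n c).IsObservable) : c (Fin.last n) ≠ 0 := by
  intro hc
  have hA : (realTriplet ω n c).A *ᵥ Pi.single 0 1 = ω • Pi.single 0 1 := by
    ext i
    rw [Matrix.mulVec_single_one]
    by_cases hi : i = 0
    · subst hi; simp [realTriplet]
    · simp [realTriplet, hi, Ne.symm hi]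
  have hk : ∀ k : ℕ, ((realTriplet ω n c).A ^ k) *ᵥ Pi.single 0 1 = ω ^ k • Pi.single 0 1 := by
    intro k
    induction k with
    | zero => rw [pow_zero, Matrix.one_mulVec, pow_zero, one_smul]
    | succ k ih => rw [pow_succ, ← Matrix.mulVec_mulVec, hA, Matrix.mulVec_smul, ih, smul_smul,
        pow_succ']
  have := h (Pi.single 0 1) fun k => by
    rw [hk, dotProduct_smul, dotProduct_single_one]
    simp [realTriplet, hc]
  simpa using congrFun this 0

end Real

section Pair

variable {α β : ℝ} {n : ℕ} {γ ε : Fin (n + 1) → ℝ}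

lemma pairTriplet_transpose_mulVec_zero (v : Fin (n + 1) × Fin 2 → ℝ) (i : Fin (n + 1)) :
    ((pairTriplet α β n γ ε).Aᵀ *ᵥ v) (i, 0) =
      α * v (i, 0) - β * v (i, 1) - shift v (i, 0) := by
  have h0 := sum_ite_ite_mul v i 0 α (-1)
  -- The `-0` is the off-diagonal entry of -I₂, kept in the form in which it appears in the unfolded
  -- sum.
  have h1 := sum_ite_ite_mul v i 1 (-β) (-0)
  simp only [Matrix.mulVec, dotProduct, Matrix.transpose_apply, pairTriplet, Matrix.of_apply,
    Fintype.sum_prod_type, Fin.sum_univ_two, Finset.sum_add_distrib, rotBlock]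
  simp only [Matrix.cons_val_zero, Matrix.cons_val_one, Matrix.one_apply_eq,
    Matrix.one_apply_ne (one_ne_zero : (1 : Fin 2) ≠ 0)]
  rw [h0, h1]
  ring

lemma pairTriplet_transpose_mulVec_one (v : Fin (n + 1) × Fin 2 → ℝ) (i : Fin (n + 1)) :
    ((pairTriplet α β n γ ε).Aᵀ *ᵥ v) (i, 1) =
      β * v (i, 0) + α * v (i, 1) - shift v (i, 1) := by
  have h0 := sum_ite_ite_mul v i 0 β (-0)
  have h1 := sum_ite_ite_mul v i 1 α (-1)
  simp only [Matrix.mulVec, dotProduct, Matrix.transpose_apply, pairTriplet, Matrix.of_apply,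
    Fintype.sum_prod_type, Fin.sum_univ_two, Finset.sum_add_distrib, rotBlock]
  simp only [Matrix.cons_val_zero, Matrix.cons_val_one, Matrix.one_apply_eq,
    Matrix.one_apply_ne (zero_ne_one : (0 : Fin 2) ≠ 1)]
  rw [h0, h1]
  ring

lemma shift_pairTriplet_zero (v : Fin (n + 1) × Fin 2 → ℝ) (i : Fin (n + 1)) :
    shift ((pairTriplet α β n γ ε).Aᵀ *ᵥ v) (i, 0) =
      α * shift v (i, 0) - β * shift v (i, 1) - shift (shift v) (i, 0) := by
  by_cases h : 0 < (i : ℕ)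
  · simp only [shift, h, dite_true, pairTriplet_transpose_mulVec_zero]
  · simp [shift, h]

lemma shift_pairTriplet_one (v : Fin (n + 1) × Fin 2 → ℝ) (i : Fin (n + 1)) :
    shift ((pairTriplet α β n γ ε).Aᵀ *ᵥ v) (i, 1) =
      β * shift v (i, 0) + α * shift v (i, 1) - shift (shift v) (i, 1) := by
  by_cases h : 0 < (i : ℕ)
  · simp only [shift, h, dite_true, pairTriplet_transpose_mulVec_one]
  · simp [shift, h]

/-- Write Aᵀ = M - s with s the shift and M the commuting block diagonal part, which the quadratic p
annihilates. Then p(Aᵀ) = -2(M - α)s + s², and M - α is β times a quarter turn. -/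
lemma pairTriplet_aeval_mulVec (hβ : β ≠ 0) (v : Fin (n + 1) × Fin 2 → ℝ) (i : Fin (n + 1)) :
    (aeval (pairTriplet α β n γ ε).Aᵀ (rootFactor ⟨α, β⟩) *ᵥ v) (i, 0) =
      2 * β * shift v (i, 1) + shift (shift v) (i, 0) ∧
    (aeval (pairTriplet α β n γ ε).Aᵀ (rootFactor ⟨α, β⟩) *ᵥ v) (i, 1) =
      -(2 * β * shift v (i, 0)) + shift (shift v) (i, 1) := by
  have hnorm : ‖(⟨α, β⟩ : ℂ)‖ ^ 2 = α * α + β * β := by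
    rw [Complex.sq_norm, Complex.normSq_apply]
  have h : aeval (pairTriplet α β n γ ε).Aᵀ (rootFactor ⟨α, β⟩) *ᵥ v =
      (pairTriplet α β n γ ε).Aᵀ *ᵥ ((pairTriplet α β n γ ε).Aᵀ *ᵥ v) -
      (2 * α) • ((pairTriplet α β n γ ε).Aᵀ *ᵥ v) + (α * α + β * β) • v := by
    rw [rootFactor, if_neg hβ, hnorm]
    simp only [map_add, map_sub, map_mul, aeval_X, aeval_C,
      Algebra.algebraMap_eq_smul_one, Matrix.add_mulVec, Matrix.sub_mulVec, Matrix.smul_mulVec,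
      smul_mul_assoc, one_mul, Matrix.one_mulVec, pow_two, Matrix.mulVec_mulVec]
    module
  rw [h]
  simp only [Pi.add_apply, Pi.sub_apply, Pi.smul_apply, smul_eq_mul,
    pairTriplet_transpose_mulVec_zero, pairTriplet_transpose_mulVec_one, shift_pairTriplet_zero,
    shift_pairTriplet_one]
  constructor <;> ring

lemma pairTriplet_aeval_pow (hβ : β ≠ 0) :
    aeval (pairTriplet α β n γ ε).Aᵀ (rootFactor ⟨α, β⟩) ^ (n + 1) = 0 := by
  have key : ∀ (m : ℕ) (v : Fin (n + 1) × Fin 2 → ℝ) (i : Fin (n + 1)), (i : ℕ) < m →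
      ∀ a, ((aeval (pairTriplet α β n γ ε).Aᵀ (rootFactor ⟨α, β⟩) ^ m) *ᵥ v) (i, a) = 0 := by
    intro m v
    induction m with
    | zero => intro i hi; omega
    | succ m ih =>
      intro i hi a
      have h1 := shift_eq_zero ih
      have h2 := shift_eq_zero h1 i (by omega)
      rw [pow_succ', ← Matrix.mulVec_mulVec]
      fin_cases a
      · refine (pairTriplet_aeval_mulVec hβ _ i).1.trans ?_
        rw [h1 i hi, h2, mul_zero, add_zero]
      · refine (pairTriplet_aeval_mulVec hβ _ i).2.trans ?_
        rw [h1 i hi, h2, mul_zero, neg_zero, add_zero]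
  refine Matrix.mulVec_injective (funext fun v => funext fun i => ?_)
  rw [key _ _ i.1 i.1.2 i.2, Matrix.zero_mulVec, Pi.zero_apply]

/-- Vectors in ker p(Aᵀ) are supported on the last group of two. There B reads the second entry and,
once that vanishes, B after Aᵀ reads β times the first. -/
lemma pairTriplet_dual_isObservable (hβ : β ≠ 0) :
    (pairTriplet α β n γ ε).dual.IsObservable := by
  refine RealTriplet.isObservable_of_aeval_pow (p := rootFactor ⟨α, β⟩) (pairTriplet_aeval_pow hβ)
    fun v hv hobs => ?_
  have hlow : ∀ m : ℕ, m ≤ n → ∀ i : Fin (n + 1), (i : ℕ) < m → ∀ a, v (i, a) = 0 := by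
    intro m
    induction m with
    | zero => intro _ i hi; omega
    | succ m ih =>
      intro hm i hi a
      have ih' := ih (by omega)
      rcases Nat.lt_succ_iff_lt_or_eq.1 hi with hlt | heq
      · exact ih' i hlt a
      have hi' : i = ⟨m, by omega⟩ := Fin.ext heq
      -- By induction the double shift vanishes at group m + 1, so the kernel equation there
      -- isolates the entries of group m.
      have h2 : ∀ a, shift (shift v) (⟨m + 1, by omega⟩, a) = 0 := fun a => by
        rw [shift_succ]
        exact shift_eq_zero ih' _ (by simp) a
      obtain ⟨e0, e1⟩ := pairTriplet_aeval_mulVec (α := α) (γ := γ) (ε := ε) hβ v ⟨m + 1, by omega⟩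
      have f0 := congrFun hv (⟨m + 1, by omega⟩, 0)
      have f1 := congrFun hv (⟨m + 1, by omega⟩, 1)
      rw [h2, shift_succ, add_zero] at e0 e1
      have g0 := e0.symm.trans f0
      have g1 := e1.symm.trans f1
      rw [hi']
      fin_cases a
      · simpa [hβ] using g1
      · simpa [hβ] using g0
  have hv1 : v (Fin.last n, 1) = 0 := by
    have h1 := hobs 0
    rw [pow_zero, Matrix.one_mulVec] at h1
    simpa [RealTriplet.dual, pairTriplet, dotProduct] using h1
  have hv0 : v (Fin.last n, 0) = 0 := by
    have h1 := hobs 1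
    have h2 : ((pairTriplet α β n γ ε).Aᵀ *ᵥ v) (Fin.last n, 1) = 0 := by
      rw [pow_one] at h1
      have h3 : (pairTriplet α β n γ ε).B = Pi.single (Fin.last n, 1) 1 := by
        ext i
        simp [pairTriplet, Pi.single_apply]
      simpa only [RealTriplet.dual, h3, single_one_dotProduct] using h1
    rw [pairTriplet_transpose_mulVec_one, hv1, shift_eq_zero (hlow n le_rfl) _ (by simp)] at h2
    simpa [hβ] using h2
  ext ⟨i, a⟩
  by_cases hi : (i : ℕ) < n
  · exact hlow n le_rfl i hi a
  · have hlast : i = Fin.last n := Fin.ext (by have := i.2; simp only [Fin.val_last]; omega)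
    subst hlast
    fin_cases a
    · exact hv0
    · exact hv1

/-- The first group of two spans an A-invariant subspace, on which C is given by the leading
coefficients; if both were 0, it would be unobservable. -/
lemma pairTriplet_leading_pos (h : (pairTriplet α β n γ ε).IsObservable) :
    0 < γ (Fin.last n) ^ 2 + ε (Fin.last n) ^ 2 := by
  by_contra hneg
  have hγ : γ (Fin.last n) = 0 := by nlinarith [sq_nonneg (γ (Fin.last n)), sq_nonneg (ε (Fin.last n))]
  have hε : ε (Fin.last n) = 0 := by nlinarith [sq_nonneg (γ (Fin.last n)), sq_nonneg (ε (Fin.last n))]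
  have hstep : ∀ v : Fin (n + 1) × Fin 2 → ℝ, (∀ i, i.1 ≠ 0 → v i = 0) →
      ∀ i, i.1 ≠ 0 → ((pairTriplet α β n γ ε).A *ᵥ v) i = 0 := by
    intro v hv i hi
    refine Finset.sum_eq_zero fun k _ => ?_
    by_cases hk : k.1 = 0
    · have : (pairTriplet α β n γ ε).A i k = 0 := by
        simp [pairTriplet, hk, Ne.symm hi]
      exact mul_eq_zero_of_left this _
    · rw [hv k hk, mul_zero]
  have hk : ∀ k : ℕ, ∀ i, i.1 ≠ 0 →
      (((pairTriplet α β n γ ε).A ^ k) *ᵥ (Pi.single (0, 0) 1)) i = 0 := by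
    intro k
    induction k with
    | zero =>
      intro i hi
      rw [pow_zero, Matrix.one_mulVec, Pi.single_eq_of_ne]
      rintro rfl
      exact hi rfl
    | succ k ih =>
      rw [pow_succ', ← Matrix.mulVec_mulVec]
      exact hstep _ ih
  have := h (Pi.single (0, 0) 1) fun k => by
    refine Finset.sum_eq_zero fun i _ => ?_
    by_cases hi : i.1 = 0
    · have : (pairTriplet α β n γ ε).C i = 0 := by
        simp [pairTriplet, hi, hγ, hε]
      rw [this, zero_mul]
    · rw [hk k i hi, mul_zero]
  simpa using congrFun this (0, 0)

end Pair

lemma dual_isObservable (b : CanonicalBlock) (hb : b.IsStandard) :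
    b.blockTriplet.dual.IsObservable :=
  match b, hb with
  | real _ _ _, _ => realTriplet_dual_isObservable
  | pair _ _ _ _ _, hb => pairTriplet_dual_isObservable (ne_of_gt hb)

lemma aeval_matA (b : CanonicalBlock) (hb : b.IsStandard) :
    aeval b.matA (rootFactor b.eigenvalue ^ (b.order + 1)) = 0 := by
  rw [← Matrix.transpose_eq_zero, ← Matrix.aeval_transpose, map_pow]
  match b, hb with
  | real ω n c, _ => exact realTriplet_aeval_pow (c := c)
  | pair α β n γ ε, hb => exact pairTriplet_aeval_pow (γ := γ) (ε := ε) (ne_of_gt hb)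

lemma card_idx (b : CanonicalBlock) (hb : b.IsStandard) :
    Fintype.card b.Idx = (rootFactor b.eigenvalue ^ (b.order + 1)).natDegree := by
  rw [(rootFactor_monic _).natDegree_pow, natDegree_rootFactor]
  match b, hb with
  | real ω n c, _ =>
    rw [eigenvalue, if_pos rfl, mul_one]
    exact Fintype.card_fin _
  | pair α β n γ ε, hb =>
    rw [eigenvalue, if_neg (ne_of_gt hb)]
    refine (Fintype.card_prod (Fin (n + 1)) (Fin 2)).trans ?_
    simp [order]

lemma isProper_of_isObservable (b : CanonicalBlock) (hb : b.IsStandard) (hpos : 0 < b.eigenvalue.re)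
    (h : b.blockTriplet.IsObservable) : b.IsProper :=
  match b, hb, hpos, h with
  | real _ _ _, _, hpos, h => ⟨hpos, realTriplet_c_ne_zero h⟩
  | pair _ _ _ _ _, hb, hpos, h => ⟨hpos, hb, pairTriplet_leading_pos h⟩

end CanonicalBlock

/-! ### Direct sums of finite families. -/

namespace RealTriplet

section Sigma

variable {o : Type} [Fintype o] [DecidableEq o] {κ : o → Type} [∀ j, Fintype (κ j)]
  [∀ j, DecidableEq (κ j)]

/-- The direct sum of a finite family of triplets. -/
def sigma (T : ∀ j, RealTriplet (κ j)) : RealTriplet (Σ j, κ j) where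
  A := Matrix.blockDiagonal' fun j => (T j).A
  B := fun i => (T i.1).B i.2
  C := fun i => (T i.1).C i.2

lemma blockDiagonal'_mulVec (M : ∀ j, Matrix (κ j) (κ j) ℝ) (v : (Σ j, κ j) → ℝ) (j : o)
    (a : κ j) :
    (Matrix.blockDiagonal' M *ᵥ v) ⟨j, a⟩ = (M j *ᵥ fun c => v ⟨j, c⟩) a := by
  rw [Matrix.mulVec, dotProduct, Fintype.sum_sigma, Finset.sum_eq_single j]
  · simp only [Matrix.blockDiagonal'_apply_eq]
    rfl
  · intro k _ hk
    refine Finset.sum_eq_zero fun c _ => ?_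
    rw [Matrix.blockDiagonal'_apply_ne _ _ _ hk.symm, zero_mul]
  · simp

lemma aeval_blockDiagonal' (M : ∀ j, Matrix (κ j) (κ j) ℝ) (f : ℝ[X]) :
    aeval (Matrix.blockDiagonal' M) f = Matrix.blockDiagonal' fun j => aeval (M j) f := by
  induction f using Polynomial.induction_on' with
  | add p q hp hq =>
    rw [map_add, hp, hq, ← Matrix.blockDiagonal'_add]
    congr 1
    ext1 j
    rw [map_add]
    rfl
  | monomial n a =>
    simp only [aeval_monomial, Algebra.algebraMap_eq_smul_one, smul_mul_assoc, one_mul]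
    rw [← Matrix.blockDiagonal'_pow, ← Matrix.blockDiagonal'_smul]
    rfl

lemma krylov_sigma (T : ∀ j, RealTriplet (κ j)) (f : ℝ[X]) (j : o) (a : κ j) :
    (sigma T).krylov f ⟨j, a⟩ = (T j).krylov f a := by
  rw [krylov_apply, sigma, aeval_blockDiagonal', blockDiagonal'_mulVec, krylov_apply]

/-- The product of the other annihilating polynomials kills all blocks but the j-th, where by
coprimality it acts invertibly. -/
lemma dual_isObservable_sigma {T : ∀ j, RealTriplet (κ j)} (hT : ∀ j, (T j).dual.IsObservable)
    {f : o → ℝ[X]} (hf : ∀ j, aeval (T j).A (f j) = 0)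
    (hcop : Pairwise fun i j => IsCoprime (f i) (f j)) : (sigma T).dual.IsObservable := by
  rw [dual_isObservable_iff]
  intro v hv
  have hzero : ∀ j g, (T j).krylov (f j * g) = 0 := fun j g => by
    rw [krylov_mul, hf, Matrix.zero_mulVec]
  have hblock : ∀ j, (fun a => v ⟨j, a⟩) = 0 := by
    intro j
    have hj : IsCoprime (f j) (∏ i ∈ Finset.univ.erase j, f i) :=
      IsCoprime.prod_right fun i hi => hcop (Finset.ne_of_mem_erase hi).symm
    obtain ⟨r, s, hrs⟩ := hj
    refine (dual_isObservable_iff (T j)).1 (hT j) _ fun h => ?_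
    have h1 := hv ((∏ i ∈ Finset.univ.erase j, f i) * (s * h))
    rw [dotProduct, Fintype.sum_sigma, Finset.sum_eq_single j] at h1
    · simp only [krylov_sigma] at h1
      rw [show h = f j * (r * h) + (∏ i ∈ Finset.univ.erase j, f i) * (s * h) by
        linear_combination -h * hrs, map_add, hzero, zero_add]
      exact h1
    · intro k _ hk
      refine Finset.sum_eq_zero fun c _ => ?_
      rw [krylov_sigma, ← Finset.mul_prod_erase _ _ (Finset.mem_erase.2 ⟨hk, Finset.mem_univ k⟩),
        mul_assoc, hzero, Pi.zero_apply, mul_zero]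
    · simp
  ext ⟨j, a⟩
  exact congrFun (hblock j) a

lemma IsObservable.of_sigma {T : ∀ j, RealTriplet (κ j)} (h : (sigma T).IsObservable) (j : o) :
    (T j).IsObservable := by
  intro v hv
  let w : (Σ j, κ j) → ℝ := fun i => if hi : i.1 = j then v (hi ▸ i.2) else 0
  have hwj : (fun c => w ⟨j, c⟩) = v := by
    ext c
    simp [w]
  have hwk : ∀ k, k ≠ j → (fun c => w ⟨k, c⟩) = 0 := fun k hk => by
    ext c
    simp [w, hk]
  have hw : w = 0 := h w fun k => by
    have hpow : (sigma T).A ^ k = Matrix.blockDiagonal' fun j => (T j).A ^ k := by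
      have := aeval_blockDiagonal' (fun j => (T j).A) (X ^ k)
      simp only [map_pow, aeval_X] at this
      exact this
    rw [hpow, dotProduct, Fintype.sum_sigma, Finset.sum_eq_single j]
    · simp only [blockDiagonal'_mulVec, hwj]
      exact hv k
    · intro i _ hi
      refine Finset.sum_eq_zero fun c _ => ?_
      rw [blockDiagonal'_mulVec, hwk i hi, Matrix.mulVec_zero, Pi.zero_apply, mul_zero]
    · simp
  rw [← hwj, hw]
  rfl

end Sigma

lemma IsSimilar.of_equiv {ι κ : Type} [Fintype ι] [DecidableEq ι] [Fintype κ] [DecidableEq κ]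
    {T : RealTriplet ι} {T' : RealTriplet κ} (E : ι ≃ κ)
    (hA : ∀ i j, T'.A (E i) (E j) = T.A i j) (hB : ∀ i, T'.B (E i) = T.B i)
    (hC : ∀ i, T'.C (E i) = T.C i) : ∃ S S', IsSimilar T T' S S' := by
  refine ⟨_, _, IsSimilar.of_linearEquiv (LinearEquiv.funCongrLeft ℝ ℝ E.symm) ?_ ?_ ?_⟩
  · intro v
    ext i
    obtain ⟨i, rfl⟩ := E.surjective i
    simp only [LinearEquiv.funCongrLeft_apply, LinearMap.funLeft_apply, Equiv.symm_apply_apply,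
      Matrix.mulVec, dotProduct]
    rw [← E.sum_comp]
    simp [hA]
  · ext i
    obtain ⟨i, rfl⟩ := E.surjective i
    simp [LinearMap.funLeft_apply, hB]
  · intro v
    rw [dotProduct, ← E.sum_comp]
    simp [LinearMap.funLeft_apply, hC, dotProduct]

end RealTriplet

/-! ### Assembling the canonical form. -/

namespace CanonicalBlock

/-- The block with prescribed row `C`. -/
def setRow : (b : CanonicalBlock) → (b.Idx → ℝ) → CanonicalBlock
  | real ω n _ => fun r => real ω n fun i => r i.rev
  | pair α β n _ _ => fun r => pair α β n (fun i => r (i.rev, 0)) fun i => r (i.rev, 1)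

/-- Prescribing the row does not change the index set. -/
def setRowEquiv : (b : CanonicalBlock) → (r : b.Idx → ℝ) → b.Idx ≃ (b.setRow r).Idx
  | real _ n _ => fun _ => Equiv.refl (Fin (n + 1))
  | pair _ _ n _ _ => fun _ => Equiv.refl (Fin (n + 1) × Fin 2)

lemma matA_setRow (b : CanonicalBlock) (r : b.Idx → ℝ) (i k : b.Idx) :
    (b.setRow r).matA (b.setRowEquiv r i) (b.setRowEquiv r k) = b.matA i k := by
  cases b <;> rfl

lemma colB_setRow (b : CanonicalBlock) (r : b.Idx → ℝ) (i : b.Idx) :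
    (b.setRow r).colB (b.setRowEquiv r i) = b.colB i := by
  cases b <;> rfl

lemma rowC_setRow (b : CanonicalBlock) (r : b.Idx → ℝ) (i : b.Idx) :
    (b.setRow r).rowC (b.setRowEquiv r i) = r i := by
  cases b with
  | real ω n c => exact congrArg r (Fin.rev_rev _)
  | pair α β n γ ε =>
    obtain ⟨i, a⟩ := i
    change (if a = 0 then r (i.rev.rev, 0) else r (i.rev.rev, 1)) = r (i, a)
    rw [Fin.rev_rev]
    fin_cases a <;> rfl

lemma eigenvalue_setRow (b : CanonicalBlock) (r : b.Idx → ℝ) :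
    (b.setRow r).eigenvalue = b.eigenvalue := by
  cases b <;> rfl

lemma IsStandard.setRow {b : CanonicalBlock} (hb : b.IsStandard) (r : b.Idx → ℝ) :
    (b.setRow r).IsStandard := by
  cases b <;> exact hb

lemma triplet_eq_sigma {m : ℕ} (b : Fin m → CanonicalBlock) :
    triplet b = RealTriplet.sigma fun j => (b j).blockTriplet := rfl

/-- The row is part of the block data, so changing it changes the index type formally; the
similarity is the identity on each block up to this relabelling. -/
lemma exists_isSimilar_setRow {m : ℕ} (b : Fin m → CanonicalBlock) (C : (Σ j, (b j).Idx) → ℝ) :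
    ∃ S S', RealTriplet.IsSimilar ⟨(triplet b).A, (triplet b).B, C⟩
      (triplet fun j => (b j).setRow fun a => C ⟨j, a⟩) S S' := by
  refine RealTriplet.IsSimilar.of_equiv
    (Equiv.sigmaCongrRight fun j => (b j).setRowEquiv fun a => C ⟨j, a⟩) ?_ ?_ ?_
  · rintro ⟨j, a⟩ ⟨k, c⟩
    simp only [triplet, Equiv.sigmaCongrRight_apply]
    by_cases h : j = k
    · subst h
      simp only [Matrix.blockDiagonal'_apply_eq, matA_setRow]
    · rw [Matrix.blockDiagonal'_apply_ne _ _ _ h, Matrix.blockDiagonal'_apply_ne _ _ _ h]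
  · rintro ⟨j, a⟩
    exact colB_setRow _ _ _
  · rintro ⟨j, a⟩
    exact rowC_setRow _ _ _

/-- The block with eigenvalue `z`, order `n + 1` and zero row. -/
noncomputable def ofRoot (z : ℂ) (n : ℕ) : CanonicalBlock :=
  if z.im = 0 then real z.re n 0 else pair z.re z.im n 0 0

lemma eigenvalue_ofRoot (z : ℂ) (n : ℕ) : (ofRoot z n).eigenvalue = z := by
  unfold ofRoot
  split_ifs with h
  · exact Complex.ext rfl h.symm
  · rfl

lemma order_ofRoot (z : ℂ) (n : ℕ) : (ofRoot z n).order = n := by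
  unfold ofRoot
  split_ifs <;> rfl

lemma isStandard_ofRoot {z : ℂ} (hz : 0 ≤ z.im) (n : ℕ) : (ofRoot z n).IsStandard := by
  unfold ofRoot
  split_ifs with h
  · trivial
  · exact lt_of_le_of_ne hz (Ne.symm h)

/-- A common root would make z and w equal or conjugate, and conjugate points of the closed upper
half-plane coincide. -/
lemma isCoprime_rootFactor_pow {z w : ℂ} (hz : 0 ≤ z.im) (hw : 0 ≤ w.im) (hzw : z ≠ w) (m n : ℕ) :
    IsCoprime (rootFactor z ^ m) (rootFactor w ^ n) := by
  apply IsCoprime.pow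
  rw [Polynomial.isCoprime_iff_aeval_ne_zero_of_isAlgClosed ℝ ℂ]
  intro a
  by_contra! ha
  have h1 := (aeval_rootFactor_eq_zero_iff z a).1 ha.1
  have h2 := (aeval_rootFactor_eq_zero_iff w a).1 ha.2
  apply hzw
  have key : ∀ {z w : ℂ}, 0 ≤ z.im → 0 ≤ w.im → z = (starRingEnd ℂ) w → z = w := fun {z w} hz hw h => by
    have h3 := congrArg Complex.im h
    rw [Complex.conj_im] at h3
    rw [h, Complex.conj_eq_iff_im]
    linarith
  rcases h1 with h1 | h1 <;> rcases h2 with h2 | h2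
  · exact h1.symm.trans h2
  · exact key hz hw (h1.symm.trans h2)
  · exact (key hw hz (h2.symm.trans h1)).symm
  · exact (starRingEnd ℂ).injective (h1.symm.trans h2)

/-- A controllable pair is similar to one in canonical form. -/
lemma exists_isSimilar_triplet {ι : Type} [Fintype ι] [DecidableEq ι] (T : RealTriplet ι)
    (h : T.dual.IsObservable) :
    ∃ (m : ℕ) (b : Fin m → CanonicalBlock) (C : (Σ j, (b j).Idx) → ℝ) (S : Matrix _ _ ℝ)
      (S' : Matrix _ _ ℝ), (∀ j, (b j).IsStandard) ∧
      (∀ j, T.IsEigenvalue (b j).eigenvalue) ∧ Function.Injective (fun j => (b j).eigenvalue) ∧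
      RealTriplet.IsSimilar T ⟨(triplet b).A, (triplet b).B, C⟩ S S' := by
  obtain ⟨M, hM, hχ⟩ := exists_eq_prod_rootFactor _ _ T.A.charpoly_monic rfl
  set e := M.toFinset.equivFin.symm
  -- One block per distinct root in the closed upper half-plane, of order its multiplicity; a block
  -- stores its order minus one.
  set b : Fin M.toFinset.card → CanonicalBlock := fun j => ofRoot (e j) (M.count (e j : ℂ) - 1)
  have hmem : ∀ j, (e j : ℂ) ∈ M := fun j => Multiset.mem_toFinset.1 (e j).2
  have hstd : ∀ j, (b j).IsStandard := fun j => isStandard_ofRoot (hM _ (hmem j)).1 _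
  have heig : ∀ j, (b j).eigenvalue = e j := fun j => eigenvalue_ofRoot _ _
  have hinj : Function.Injective (fun j => (b j).eigenvalue) := fun i j hij => by
    simp only [heig] at hij
    exact e.injective (Subtype.ext hij)
  have hord : ∀ j, (b j).order + 1 = M.count (e j : ℂ) := fun j => by
    rw [order_ofRoot]
    exact Nat.sub_add_cancel (Multiset.one_le_count_iff_mem.2 (hmem j))
  have hprod : T.A.charpoly = ∏ j, rootFactor (b j).eigenvalue ^ ((b j).order + 1) := by
    simp only [heig, hord]
    rw [e.prod_comp fun z => rootFactor z ^ M.count (z : ℂ),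
      Finset.prod_coe_sort M.toFinset fun z => rootFactor z ^ M.count z, hχ,
      Finset.prod_multiset_map_count]
  have hcop : Pairwise fun i j => IsCoprime (rootFactor (b i).eigenvalue ^ ((b i).order + 1))
      (rootFactor (b j).eigenvalue ^ ((b j).order + 1)) := fun i j hij => by
    refine isCoprime_rootFactor_pow ?_ ?_ (fun h => hij (hinj h)) _ _
    · exact (congrArg Complex.im (heig i)).symm ▸ (hM _ (hmem i)).1
    · exact (congrArg Complex.im (heig j)).symm ▸ (hM _ (hmem j)).1
  have hdual : (triplet b).dual.IsObservable := by
    rw [triplet_eq_sigma]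
    exact RealTriplet.dual_isObservable_sigma (fun j => (b j).dual_isObservable (hstd j))
      (fun j => (b j).aeval_matA (hstd j)) hcop
  have hcard : T.A.charpoly.natDegree = Fintype.card (Σ j, (b j).Idx) := by
    rw [hprod, natDegree_prod_of_monic _ _ fun j _ => (rootFactor_monic _).pow _, Fintype.card_sigma]
    exact Finset.sum_congr rfl fun j _ => ((b j).card_idx (hstd j)).symm
  have hzero : aeval (triplet b).A T.A.charpoly = 0 := by
    rw [triplet, RealTriplet.aeval_blockDiagonal', ← Matrix.blockDiagonal'_zero]
    congr 1
    ext1 j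
    rw [hprod, ← Finset.prod_erase_mul _ _ (Finset.mem_univ j), map_mul,
      (b j).aeval_matA (hstd j), mul_zero]
    rfl
  obtain ⟨C, S, S', hsim⟩ := RealTriplet.exists_isSimilar h hdual T.A.charpoly_monic
    (Matrix.charpoly_natDegree_eq_dim _) hcard (Matrix.aeval_self_charpoly _) hzero
  refine ⟨_, b, C, S, S', hstd, fun j => ?_, hinj, hsim⟩
  rw [heig, RealTriplet.isEigenvalue_iff_aeval_charpoly]
  exact (hM _ (hmem j)).2

end CanonicalBlock

/-- Every admissible triplet is equivalent to an admissible triplet in canonical form.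
Since `β > 0` in every block of a complex pair, injectivity of `eigenvalue` says that different
blocks have no eigenvalue in common. -/
theorem theorem4p3 {p : ℕ} (hp : 0 < p) (T : RealTriplet (Fin p)) (hT : T.IsAdmissible) :
    ∃ (m : ℕ) (b : Fin m → CanonicalBlock),
      0 < m ∧
      (∀ j, (b j).IsProper) ∧
      Function.Injective (fun j => (b j).eigenvalue) ∧
      (CanonicalBlock.triplet b).IsAdmissible ∧
      T.Equivalent (CanonicalBlock.triplet b) := by
  obtain ⟨k, l, T', hcard, hmin, hpos, u, hu, hu'⟩ := hT.exists_equivalent_pos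
  obtain ⟨m, b, C, S, S', hstd, heig, hinj, hsim⟩ :=
    CanonicalBlock.exists_isSimilar_triplet T' hmin.2
  obtain ⟨R, R', hsim'⟩ := CanonicalBlock.exists_isSimilar_setRow b C
  have hadm := hsim'.isAdmissible (hsim.isAdmissible (hmin.isAdmissible_of_pos hpos))
  have hadm₀ := hsim.isAdmissible (hmin.isAdmissible_of_pos hpos)
  refine ⟨m, fun j => (b j).setRow fun a => C ⟨j, a⟩, ?_, fun j => ?_, ?_, hadm, u, hu, ?_⟩
  -- With m = 0 the canonical index type is empty, so S' S = 0, contradicting S' S = 1 on a nonempty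
  -- index type.
  · rcases Nat.eq_zero_or_pos m with rfl | hm
    · exfalso
      have : Nonempty (Fin k ⊕ Fin l) := by
        rw [← Fintype.card_pos_iff, Fintype.card_sum, Fintype.card_fin, Fintype.card_fin, hcard,
          Fintype.card_fin]
        exact hp
      have h1 := hsim.inv_mul
      obtain ⟨i⟩ := this
      have h2 := congrFun (congrFun h1 i) i
      rw [Matrix.mul_apply, Matrix.one_apply_eq] at h2
      simp at h2
    · exact hm
  · refine CanonicalBlock.isProper_of_isObservable _ ((hstd j).setRow _) ?_
      (RealTriplet.IsObservable.of_sigma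
        (T := fun j => ((b j).setRow fun a => C ⟨j, a⟩).blockTriplet) hadm.minimal.1 j)
    rw [CanonicalBlock.eigenvalue_setRow]
    exact hpos _ (heig j)
  · simpa only [CanonicalBlock.eigenvalue_setRow] using hinj
  · exact hsim'.symm.leadsTo hadm.spectrumSplit (hsim.symm.leadsTo hadm₀.spectrumSplit hu')
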